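/- For a finite set $A$ of positive integers let $T_n(x)=\frac1{x+n}$ $(n\in A)$, write $[a_1,\dots,a_n]=T_{a_1}\circ\cdots\circ T_{a_n}(0)$ for the finite continued fraction $1/(a_1+1/(a_2+\cdots+1/a_n))$, and let $X_A=\{\lim_{n\to\infty}[a_1,\dots,a_n] : a_k\in A \text{ for all } k\}$ be the limit set. For $0\le t\le 1$ let $(\mathcal L_tf)(x)=\sum_{n\in A}f(T_n(x))\,|T_n'(x)|^t$. Call a function on $[0,1]$ positive Hölder if it takes only positive values and is Hölder continuous with some exponent $\alpha\in(0,1]$. Hensley's conjecture asserts: for every finite $A\subset\{1,2,\dots\}$ with $\dim_H X_A>\frac12$ there is $q_0>0$ such that for every natural number $q\ge q_0$ there exist a natural number $p<q$, some $n\ge1$ and $a_1,\dots,a_n\in A$ with $\frac pq=[a_1,\dots,a_n]$. Now let $A=\{2,4,6,8,10\}$. Then: 1. With $t_0=0.5173570309\,3701730466\,6628474836\,4397337$ one has $t_0<\dim_H X_A<t_0+10^{-37}$, that is, $\dim_H X_A=0.5173570309\,3701730466\,6628474836\,4397337\ldots$ In particular $\dim_H X_A>\frac12$. 2. If $0\le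 t\le1$ and $f$ is a positive Hölder function on $[0,1]$ with $\inf_{[0,1]}\frac{\mathcal L_tf}{f}>1$, then $\dim_H X_A>t$. The function $f(x)=8-2x$ is positive Hölder on $[0,1]$ and satisfies $\inf_{[0,1]}\frac{\mathcal L_{1/2}f}{f}>1$; so it, too, gives $\dim_HX_A>\frac12$. 3. If $p,q$ are coprime natural numbers and $\frac pq=[a_1,\dots,a_n]$ with $n\ge1$ and $a_1,\dots,a_n\in A$, then $q\not\equiv3\pmod 4$. 4. There is no $q_0>0$ such that for every natural number $q\ge q_0$ there exist a natural number $p<q$, some $n\ge1$ and $a_1,\dots,a_n\in A$ with $\frac pq=[a_1,\dots,a_n]$. Hence Hensley's conjecture is false, with $A$ as a counterexample. -/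

import Mathlib

open Set Filter Topology
open scoped NNReal ENNReal

/-- The inverse branch `T_n(x) = 1 / (x + n)` of the Gauss map. -/
noncomputable def cfBranch (n : ℕ) (x : ℝ) : ℝ := 1 / (x + n)

/-- The finite continued fraction `[a₁, …, aₙ] = 1 / (a₁ + 1 / (a₂ + ⋯ + 1 / aₙ))`,
that is, `T_{a₁} ∘ ⋯ ∘ T_{aₙ} (0)`. -/
noncomputable def cfValue (l : List ℕ) : ℝ := l.foldr cfBranch 0

/-- The limit set `X_A` of the iterated function scheme `{T_n : n ∈ A}` : all the limits
`lim_n T_{a 0} ∘ ⋯ ∘ T_{a (n - 1)} (0)` over the sequences `a` with values in `A`. -/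
def cfLimitSet (A : Finset ℕ) : Set ℝ :=
  {x | ∃ a : ℕ → ℕ, (∀ n, a n ∈ A) ∧
    Tendsto (fun n : ℕ => cfValue ((List.range n).map a)) atTop (𝓝 x)}

/-- The transfer operator `L_t f = ∑_{n ∈ A} f(T_n) |T_n'|^t`. -/
noncomputable def cfTransfer (A : Finset ℕ) (t : ℝ) (f : ℝ → ℝ) (x : ℝ) : ℝ :=
  ∑ n ∈ A, f (cfBranch n x) * |deriv (cfBranch n) x| ^ t

/-- Positive Hölder functions on `[0, 1]`, with some exponent `0 < α ≤ 1`
(only the values on `[0, 1]` matter). -/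
def IsPositiveHolder (f : ℝ → ℝ) : Prop :=
  (∃ C α : ℝ≥0, 0 < α ∧ α ≤ 1 ∧ HolderOnWith C α f (Icc 0 1)) ∧ ∀ x ∈ Icc (0 : ℝ) 1, 0 < f x

/-- `p / q = [a₁, …, aₙ]` for some `n ≥ 1` and some digits `a₁, …, aₙ ∈ A`. -/
def HasDigitsIn (A : Finset ℕ) (p q : ℕ) : Prop :=
  ∃ l : List ℕ, l ≠ [] ∧ (∀ a ∈ l, a ∈ A) ∧ (p : ℝ) / (q : ℝ) = cfValue l

/-- Every large `q` is a denominator of a finite continued fraction with digits in `A`.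
The fraction `p / q` need not be in lowest terms here; asking for that as well gives a stronger
property, so the negation of this one is the stronger negation. -/
def HensleyProperty (A : Finset ℕ) : Prop :=
  ∃ q₀ : ℕ, 0 < q₀ ∧ ∀ q : ℕ, q₀ ≤ q → ∃ p : ℕ, p < q ∧ HasDigitsIn A p q

/-- Hensley's conjecture: the property above holds for every finite alphabet of positive integers
whose limit set has Hausdorff dimension larger than `1 / 2`. -/
def HensleyConjecture : Prop :=
  ∀ A : Finset ℕ, (∀ a ∈ A, 1 ≤ a) → (1 / 2 : ℝ≥0∞) < dimH (cfLimitSet A) → HensleyProperty A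

/-- The alphabet `{2, 4, 6, 8, 10}`. -/
def evenAlphabet : Finset ℕ := {2, 4, 6, 8, 10}

/-!
Write `r x + s` for the denominator of the Möbius map `T_{a₁} ∘ ⋯ ∘ T_{aₙ}`. Its derivative has
absolute value `(r x + s)⁻²`, so the `n`-th iterate of `L_t` is governed by the partition sums
`∑ (r x + s)^(-2t)` over the words of length `n`. If `L_t f ≤ f` for a function `f` bounded
away from `0` and `∞`, these sums stay bounded, and the cylinders, whose diameters are of order
`s⁻²`, cover the limit set so well that its dimension is at most `t`. If `f ≤ L_t f`, the sums stay
bounded below. The cylinder of the longest word shared by the expansions of all points of a set `U`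
is at most a constant times longer than `U`, so covers of the limit set by arbitrary sets are hardly
more economical than those by finitely many cylinders, and the dimension is at least `t`.

The transfer operator at `t ≈ dim X_A` has a real analytic fixed function, so some polynomial is
fixed to within `10⁻³⁹` on an interval that all the branches map into itself. Each weight
`(x + a)^(-2t)` decreases in `t` at the relative rate `2 log (x + a) ≥ 2 log 2 > 1`, so moving `t`
by a few multiples of `10⁻³⁸` beats that error, and the dimension is enclosed to 37 digits.

For even digits the map `(p, q) ↦ (q, p + a q)` preserves the set of pairs `(0, 1)`, `(2, 1)`,
`(1, 0)`, `(1, 2)` modulo `4`, so no reduced denominator is `3` modulo `4`. A fraction with prime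
denominator and smaller positive numerator is reduced, and by Dirichlet's theorem there are
arbitrarily large primes congruent to `3` modulo `4`.
-/

/-! ### Words and their denominators -/

/-- The composition `T_{a₁} ∘ ⋯ ∘ T_{aₙ}` of the inverse branches along a word. -/
noncomputable def cfMap (l : List ℕ) (x : ℝ) : ℝ := l.foldr cfBranch x

/-- The denominator `r x + s` of the Möbius map `cfMap l x = (p x + q) / (r x + s)`, as the product
of the denominators of its branches. The derivative of `cfMap l` has absolute value
`(cfDenom l x)⁻¹ ^ 2`. -/
noncomputable def cfDenom : List ℕ → ℝ → ℝ
  | [], _ => 1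
  | a :: l, x => (cfMap l x + a) * cfDenom l x

@[simp] lemma cfMap_nil (x : ℝ) : cfMap [] x = x := rfl

@[simp] lemma cfMap_cons (a : ℕ) (l : List ℕ) (x : ℝ) :
    cfMap (a :: l) x = cfBranch a (cfMap l x) := rfl

lemma cfMap_append (l m : List ℕ) (x : ℝ) : cfMap (l ++ m) x = cfMap l (cfMap m x) := by
  simp only [cfMap, List.foldr_append]

lemma cfValue_eq_cfMap (l : List ℕ) : cfValue l = cfMap l 0 := rfl

@[simp] lemma cfDenom_nil (x : ℝ) : cfDenom [] x = 1 := rfl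

@[simp] lemma cfDenom_cons (a : ℕ) (l : List ℕ) (x : ℝ) :
    cfDenom (a :: l) x = (cfMap l x + a) * cfDenom l x := rfl

lemma cfDenom_append (l m : List ℕ) (x : ℝ) :
    cfDenom (l ++ m) x = cfDenom l (cfMap m x) * cfDenom m x := by
  induction l with
  | nil => simp
  | cons a l ih => simp only [List.cons_append, cfDenom_cons, ih, cfMap_append, mul_assoc]

lemma cfMap_mem_of_invariant {A : Finset ℕ} {J : Set ℝ}
    (hinv : ∀ a ∈ A, ∀ x ∈ J, cfBranch a x ∈ J) {l : List ℕ} (hl : ∀ a ∈ l, a ∈ A) {x : ℝ}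
    (hx : x ∈ J) : cfMap l x ∈ J := by
  induction l with
  | nil => exact hx
  | cons a l ih =>
    rw [List.forall_mem_cons] at hl
    exact hinv a hl.1 _ (ih hl.2)

lemma cfBranch_mem_Icc {a : ℕ} (ha : 1 ≤ a) {x : ℝ} (hx : 0 ≤ x) :
    cfBranch a x ∈ Icc (0 : ℝ) 1 := by
  have ha' : (1 : ℝ) ≤ a := by exact_mod_cast ha
  exact ⟨by unfold cfBranch; positivity, div_le_one_of_le₀ (by linarith) (by linarith)⟩

section

variable {l : List ℕ} {x y : ℝ}

lemma cfMap_nonneg (l : List ℕ) (hx : 0 ≤ x) : 0 ≤ cfMap l x := by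
  induction l with
  | nil => exact hx
  | cons a l ih => rw [cfMap_cons, cfBranch]; positivity

lemma cfMap_mem_Icc (hl : ∀ a ∈ l, 1 ≤ a) (hx : x ∈ Icc (0 : ℝ) 1) : cfMap l x ∈ Icc (0 : ℝ) 1 := by
  cases l with
  | nil => exact hx
  | cons a l => exact cfBranch_mem_Icc (hl a (by simp)) (cfMap_nonneg l hx.1)

lemma cfMap_add_pos {a : ℕ} (ha : 1 ≤ a) (l : List ℕ) (hx : 0 ≤ x) : 0 < cfMap l x + a :=
  add_pos_of_nonneg_of_pos (cfMap_nonneg l hx) (by exact_mod_cast ha)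

lemma cfDenom_pos (hl : ∀ a ∈ l, 1 ≤ a) (hx : 0 ≤ x) : 0 < cfDenom l x := by
  induction l with
  | nil => exact one_pos
  | cons a l ih =>
    rw [List.forall_mem_cons] at hl
    exact mul_pos (cfMap_add_pos hl.1 l hx) (ih hl.2)

lemma cfMap_cons_mul_cfDenom_cons {a : ℕ} (ha : 1 ≤ a) (l : List ℕ) (hx : 0 ≤ x) :
    cfMap (a :: l) x * cfDenom (a :: l) x = cfDenom l x := by
  have := cfMap_add_pos ha l hx
  rw [cfMap_cons, cfDenom_cons, cfBranch]
  field_simp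

lemma cfDenom_zero_le_and_mul_le (hl : ∀ a ∈ l, 1 ≤ a) (hx : 0 ≤ x) :
    cfDenom l 0 ≤ cfDenom l x ∧ cfMap l 0 * cfDenom l 0 ≤ cfMap l x * cfDenom l x := by
  induction l with
  | nil => simpa using hx
  | cons a l ih =>
    rw [List.forall_mem_cons] at hl
    obtain ⟨hden, hnum⟩ := ih hl.2
    rw [cfMap_cons_mul_cfDenom_cons hl.1 l hx, cfMap_cons_mul_cfDenom_cons hl.1 l le_rfl]
    refine ⟨?_, hden⟩
    simp only [cfDenom_cons, add_mul]
    gcongr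

lemma cfDenom_zero_le (hl : ∀ a ∈ l, 1 ≤ a) (hx : 0 ≤ x) : cfDenom l 0 ≤ cfDenom l x :=
  (cfDenom_zero_le_and_mul_le hl hx).1

lemma cfDenom_le_and_add_le (hl : ∀ a ∈ l, 1 ≤ a) (hx : x ∈ Icc (0 : ℝ) 1) :
    cfDenom l x ≤ 2 * cfDenom l 0 ∧
      (cfMap l x + 1) * cfDenom l x ≤ 2 * ((cfMap l 0 + 1) * cfDenom l 0) := by
  induction l with
  | nil => simp only [cfDenom_nil, cfMap_nil]; constructor <;> linarith [hx.2]
  | cons a l ih =>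
    rw [List.forall_mem_cons] at hl
    obtain ⟨hden, hsum⟩ := ih hl.2
    have ha : (1 : ℝ) ≤ a := by exact_mod_cast hl.1
    have hstep : cfDenom (a :: l) x ≤ 2 * cfDenom (a :: l) 0 := by
      have := mul_le_mul_of_nonneg_left hden (sub_nonneg.2 ha)
      simp only [cfDenom_cons]
      linarith
    refine ⟨hstep, ?_⟩
    rw [add_mul, add_mul, cfMap_cons_mul_cfDenom_cons hl.1 l hx.1,
      cfMap_cons_mul_cfDenom_cons hl.1 l le_rfl]
    linarith

lemma cfDenom_le_two_mul (hl : ∀ a ∈ l, 1 ≤ a) (hx : x ∈ Icc (0 : ℝ) 1) :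
    cfDenom l x ≤ 2 * cfDenom l 0 :=
  (cfDenom_le_and_add_le hl hx).1

lemma two_pow_length_le_add_mul (hl : ∀ a ∈ l, 1 ≤ a) :
    2 ^ l.length ≤ (cfMap l 0 + 1) * cfDenom l 0 * cfDenom l 0 := by
  induction l with
  | nil => simp
  | cons a l ih =>
    rw [List.forall_mem_cons] at hl
    have ha : (1 : ℝ) ≤ a := by exact_mod_cast hl.1
    have hD := cfDenom_pos hl.2 le_rfl
    have hN : 0 ≤ cfMap l 0 * cfDenom l 0 := mul_nonneg (cfMap_nonneg l le_rfl) hD.le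
    have hstep : (cfMap l 0 + 1) * cfDenom l 0 ≤ cfDenom (a :: l) 0 := by
      rw [cfDenom_cons]; gcongr
    rw [add_mul _ _ (cfDenom (a :: l) 0), cfMap_cons_mul_cfDenom_cons hl.1 l le_rfl,
      List.length_cons, pow_succ]
    nlinarith [ih hl.2]

lemma inv_sq_cfDenom_le (hl : ∀ a ∈ l, 1 ≤ a) :
    (cfDenom l 0 ^ 2)⁻¹ ≤ 2 * (1 / 2) ^ l.length := by
  have hD := cfDenom_pos hl le_rfl
  have hpow : 2 ^ l.length ≤ 2 * cfDenom l 0 ^ 2 := by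
    have hle := (cfMap_mem_Icc hl (left_mem_Icc.2 zero_le_one)).2
    nlinarith [two_pow_length_le_add_mul hl, sq_nonneg (cfDenom l 0)]
  rw [one_div_pow, mul_one_div, inv_le_comm₀ (by positivity) (by positivity), inv_div,
    div_le_iff₀' two_pos]
  exact hpow

lemma abs_cfMap_sub (hl : ∀ a ∈ l, 1 ≤ a) (hx : 0 ≤ x) (hy : 0 ≤ y) :
    |cfMap l x - cfMap l y| = |x - y| / (cfDenom l x * cfDenom l y) := by
  induction l with
  | nil => simp
  | cons a l ih =>
    rw [List.forall_mem_cons] at hl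
    have hX := cfMap_add_pos hl.1 l hx
    have hY := cfMap_add_pos hl.1 l hy
    have hsub : cfMap (a :: l) x - cfMap (a :: l) y =
        -(cfMap l x - cfMap l y) / ((cfMap l x + a) * (cfMap l y + a)) := by
      simp only [cfMap_cons, cfBranch]; field_simp; ring
    rw [hsub, abs_div, abs_neg, ih hl.2, abs_of_pos (mul_pos hX hY), cfDenom_cons, cfDenom_cons,
      div_div]
    congr 1
    ring

lemma abs_cfMap_sub_le (hl : ∀ a ∈ l, 1 ≤ a) (hx : 0 ≤ x) (hy : 0 ≤ y) :
    |cfMap l x - cfMap l y| ≤ |x - y| * (cfDenom l 0 ^ 2)⁻¹ := by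
  have h0 := cfDenom_pos hl le_rfl
  have hx0 := (cfDenom_pos hl hx).le
  rw [abs_cfMap_sub hl hx hy, div_eq_mul_inv, sq]
  gcongr
  exacts [cfDenom_zero_le hl hx, cfDenom_zero_le hl hy]

lemma le_abs_cfMap_sub (hl : ∀ a ∈ l, 1 ≤ a) (hx : x ∈ Icc (0 : ℝ) 1) (hy : y ∈ Icc (0 : ℝ) 1) :
    |x - y| * (4 * cfDenom l 0 ^ 2)⁻¹ ≤ |cfMap l x - cfMap l y| := by
  have h0 := cfDenom_pos hl le_rfl
  have hx0 := cfDenom_pos hl hx.1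
  have hy0 := cfDenom_pos hl hy.1
  rw [abs_cfMap_sub hl hx.1 hy.1, div_eq_mul_inv,
    show 4 * cfDenom l 0 ^ 2 = 2 * cfDenom l 0 * (2 * cfDenom l 0) by ring]
  gcongr
  exacts [cfDenom_le_two_mul hl hx, cfDenom_le_two_mul hl hy]

end

/-! ### Words of a given length -/

/-- The words of length `n` over the alphabet `A`. -/
def cfWords (A : Finset ℕ) : ℕ → Finset (List ℕ)
  | 0 => {[]}
  | n + 1 => (A ×ˢ cfWords A n).image fun p => p.1 :: p.2

lemma mem_cfWords {A : Finset ℕ} {n : ℕ} {l : List ℕ} :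
    l ∈ cfWords A n ↔ l.length = n ∧ ∀ a ∈ l, a ∈ A := by
  induction n generalizing l with
  | zero =>
    rw [cfWords, Finset.mem_singleton, List.length_eq_zero_iff]
    exact ⟨fun h => ⟨h, by simp [h]⟩, And.left⟩
  | succ n ih =>
    cases l with
    | nil => simp [cfWords]
    | cons a l => simp [cfWords, ih]; tauto

lemma sum_cfWords_succ (A : Finset ℕ) (n : ℕ) (F : List ℕ → ℝ) :
    ∑ l ∈ cfWords A (n + 1), F l = ∑ l ∈ cfWords A n, ∑ a ∈ A, F (a :: l) := by
  rw [cfWords, Finset.sum_image fun p _ q _ h => Prod.ext_iff.2 (List.cons.inj h),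
    Finset.sum_product, Finset.sum_comm]

lemma sum_cfWords_add (A : Finset ℕ) (n m : ℕ) (F : List ℕ → ℝ) :
    ∑ l ∈ cfWords A (n + m), F l = ∑ w ∈ cfWords A n, ∑ u ∈ cfWords A m, F (w ++ u) := by
  induction n generalizing F with
  | zero => simp [cfWords]
  | succ n ih =>
    rw [Nat.add_right_comm, sum_cfWords_succ, ih, sum_cfWords_succ]
    exact Finset.sum_congr rfl fun w _ => Finset.sum_comm

lemma filter_prefix_cfWords {A : Finset ℕ} {w : List ℕ} (hw : ∀ a ∈ w, a ∈ A) (m : ℕ) :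
    {u ∈ cfWords A (w.length + m) | w <+: u} = (cfWords A m).image (w ++ ·) := by
  ext u
  simp only [Finset.mem_filter, Finset.mem_image, mem_cfWords]
  constructor
  · rintro ⟨⟨hlen, hu⟩, v, rfl⟩
    rw [List.forall_mem_append] at hu
    exact ⟨v, ⟨by simpa using hlen, hu.2⟩, rfl⟩
  · rintro ⟨v, ⟨hlen, hv⟩, rfl⟩
    exact ⟨⟨by simp [hlen], List.forall_mem_append.2 ⟨hw, hv⟩⟩, List.prefix_append w v⟩

/-! ### The transfer operator and the partition function -/

lemma cfTransfer_eq {A : Finset ℕ} (hA : ∀ a ∈ A, 1 ≤ a) (t : ℝ) (f : ℝ → ℝ) {x : ℝ}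
    (hx : 0 ≤ x) :
    cfTransfer A t f x = ∑ a ∈ A, f (cfBranch a x) * (x + a) ^ (-(2 * t)) := by
  refine Finset.sum_congr rfl fun a ha => ?_
  have hpos : 0 < x + a := cfMap_add_pos (hA a ha) [] hx
  have hderiv : HasDerivAt (cfBranch a) (-1 / (x + a) ^ 2) x := by
    have hbranch : cfBranch a = fun y => (y + (a : ℝ))⁻¹ := funext fun y => one_div _
    rw [hbranch]
    exact ((hasDerivAt_id x).add_const _).inv hpos.ne'
  rw [hderiv.deriv, abs_div, abs_neg, abs_one, abs_of_pos (by positivity : 0 < (x + a) ^ 2),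
    one_div, Real.inv_rpow (by positivity), ← Real.rpow_natCast, ← Real.rpow_mul hpos.le,
    ← Real.rpow_neg hpos.le, Nat.cast_ofNat]

section Transfer

variable {A : Finset ℕ} {t m M : ℝ} {f : ℝ → ℝ} {J : Set ℝ}

lemma iterate_cfTransfer_eq (hA : ∀ a ∈ A, 1 ≤ a) (n : ℕ) {x : ℝ} (hx : 0 ≤ x) :
    (cfTransfer A t)^[n] f x = ∑ l ∈ cfWords A n, f (cfMap l x) * cfDenom l x ^ (-(2 * t)) := by
  induction n generalizing f with
  | zero => simp [cfWords]
  | succ n ih =>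
    rw [Function.iterate_succ_apply, ih, sum_cfWords_succ]
    refine Finset.sum_congr rfl fun l hl => ?_
    have hl1 : ∀ a ∈ l, 1 ≤ a := fun a ha => hA a ((mem_cfWords.1 hl).2 a ha)
    rw [cfTransfer_eq hA t f (cfMap_nonneg l hx), Finset.sum_mul]
    refine Finset.sum_congr rfl fun a ha => ?_
    rw [cfMap_cons, cfDenom_cons, Real.mul_rpow (cfMap_add_pos (hA a ha) l hx).le
      (cfDenom_pos hl1 hx).le, mul_assoc]

lemma cfTransfer_mono {g : ℝ → ℝ} (hinv : ∀ a ∈ A, ∀ x ∈ J, cfBranch a x ∈ J)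
    (hfg : ∀ x ∈ J, f x ≤ g x) : ∀ x ∈ J, cfTransfer A t f x ≤ cfTransfer A t g x :=
  fun x hx => Finset.sum_le_sum fun a ha => by
    have := hfg _ (hinv a ha x hx)
    gcongr

lemma le_iterate_cfTransfer (hinv : ∀ a ∈ A, ∀ x ∈ J, cfBranch a x ∈ J)
    (hf : ∀ x ∈ J, f x ≤ cfTransfer A t f x) (n : ℕ) :
    ∀ x ∈ J, f x ≤ (cfTransfer A t)^[n] f x := by
  induction n with
  | zero => exact fun x _ => le_rfl
  | succ n ih =>
    intro x hx
    rw [Function.iterate_succ_apply']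
    exact (hf x hx).trans (cfTransfer_mono hinv ih x hx)

lemma iterate_cfTransfer_le (hinv : ∀ a ∈ A, ∀ x ∈ J, cfBranch a x ∈ J)
    (hf : ∀ x ∈ J, cfTransfer A t f x ≤ f x) (n : ℕ) :
    ∀ x ∈ J, (cfTransfer A t)^[n] f x ≤ f x := by
  induction n with
  | zero => exact fun x _ => le_rfl
  | succ n ih =>
    intro x hx
    rw [Function.iterate_succ_apply']
    exact (cfTransfer_mono hinv ih x hx).trans (hf x hx)

/-- The partition function `∑_{|l| = n} |T_l'(0)|^t` of the inverse branches. -/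
noncomputable def cfPartition (A : Finset ℕ) (t : ℝ) (n : ℕ) : ℝ :=
  ∑ l ∈ cfWords A n, cfDenom l 0 ^ (-(2 * t))

lemma one_le_of_mem_cfWords (hA : ∀ a ∈ A, 1 ≤ a) {n : ℕ} {l : List ℕ} (hl : l ∈ cfWords A n) :
    ∀ a ∈ l, 1 ≤ a :=
  fun a ha => hA a ((mem_cfWords.1 hl).2 a ha)

lemma cfDenom_rpow_le (ht : 0 ≤ t) {l : List ℕ} (hl : ∀ a ∈ l, 1 ≤ a) {x : ℝ} (hx : 0 ≤ x) :
    cfDenom l x ^ (-(2 * t)) ≤ cfDenom l 0 ^ (-(2 * t)) :=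
  Real.rpow_le_rpow_of_nonpos (cfDenom_pos hl le_rfl) (cfDenom_zero_le hl hx) (by linarith)

lemma cfDenom_zero_rpow_le (ht : 0 ≤ t) {l : List ℕ} (hl : ∀ a ∈ l, 1 ≤ a) {x : ℝ}
    (hx : x ∈ Icc (0 : ℝ) 1) :
    cfDenom l 0 ^ (-(2 * t)) ≤ 2 ^ (2 * t) * cfDenom l x ^ (-(2 * t)) := by
  have h0 := cfDenom_pos hl le_rfl
  have hle := Real.rpow_le_rpow_of_nonpos (cfDenom_pos hl hx.1) (cfDenom_le_two_mul hl hx)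
    (by linarith : -(2 * t) ≤ 0)
  rw [Real.mul_rpow two_pos.le h0.le, Real.rpow_neg two_pos.le, inv_mul_le_iff₀ (by positivity)]
    at hle
  exact hle

lemma cfPartition_nonneg (hA : ∀ a ∈ A, 1 ≤ a) (n : ℕ) : 0 ≤ cfPartition A t n :=
  Finset.sum_nonneg fun _ hl =>
    Real.rpow_nonneg (cfDenom_pos (one_le_of_mem_cfWords hA hl) le_rfl).le _

lemma div_le_cfPartition (hA : ∀ a ∈ A, 1 ≤ a) (ht : 0 ≤ t) (hJ : J ⊆ Icc 0 1)
    (hJne : J.Nonempty) (hinv : ∀ a ∈ A, ∀ x ∈ J, cfBranch a x ∈ J) (hm : 0 < m)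
    (hmM : ∀ x ∈ J, f x ∈ Icc m M) (hf : ∀ x ∈ J, f x ≤ cfTransfer A t f x) (n : ℕ) :
    m / M ≤ cfPartition A t n := by
  obtain ⟨x, hx⟩ := hJne
  have hM : 0 < M := hm.trans_le ((hmM x hx).1.trans (hmM x hx).2)
  rw [div_le_iff₀' hM]
  calc m ≤ (cfTransfer A t)^[n] f x := (hmM x hx).1.trans (le_iterate_cfTransfer hinv hf n x hx)
    _ = ∑ l ∈ cfWords A n, f (cfMap l x) * cfDenom l x ^ (-(2 * t)) :=
      iterate_cfTransfer_eq hA n (hJ hx).1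
    _ ≤ ∑ l ∈ cfWords A n, M * cfDenom l 0 ^ (-(2 * t)) := Finset.sum_le_sum fun l hl => by
      have hl1 := one_le_of_mem_cfWords hA hl
      have hpos := cfDenom_pos hl1 (hJ hx).1
      exact mul_le_mul (hmM _ (cfMap_mem_of_invariant hinv (mem_cfWords.1 hl).2 hx)).2
        (cfDenom_rpow_le ht hl1 (hJ hx).1) (by positivity) hM.le
    _ = M * cfPartition A t n := (Finset.mul_sum ..).symm

lemma cfPartition_le (hA : ∀ a ∈ A, 1 ≤ a) (ht : 0 ≤ t) (hJ : J ⊆ Icc 0 1)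
    (hJne : J.Nonempty) (hinv : ∀ a ∈ A, ∀ x ∈ J, cfBranch a x ∈ J) (hm : 0 < m)
    (hmM : ∀ x ∈ J, f x ∈ Icc m M) (hf : ∀ x ∈ J, cfTransfer A t f x ≤ f x) (n : ℕ) :
    cfPartition A t n ≤ 2 ^ (2 * t) * (M / m) := by
  obtain ⟨x, hx⟩ := hJne
  rw [← mul_div_assoc, le_div_iff₀' hm]
  calc m * cfPartition A t n = ∑ l ∈ cfWords A n, m * cfDenom l 0 ^ (-(2 * t)) := Finset.mul_sum ..
    _ ≤ ∑ l ∈ cfWords A n, f (cfMap l x) * (2 ^ (2 * t) * cfDenom l x ^ (-(2 * t))) :=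
      Finset.sum_le_sum fun l hl => by
        have hl1 := one_le_of_mem_cfWords hA hl
        have hpos := cfDenom_pos hl1 (le_refl (0 : ℝ))
        have hfm := (hmM _ (cfMap_mem_of_invariant hinv (mem_cfWords.1 hl).2 hx)).1
        exact mul_le_mul hfm (cfDenom_zero_rpow_le ht hl1 (hJ hx)) (by positivity) (hm.le.trans hfm)
    _ = 2 ^ (2 * t) * (cfTransfer A t)^[n] f x := by
      rw [iterate_cfTransfer_eq hA n (hJ hx).1, Finset.mul_sum]
      exact Finset.sum_congr rfl fun l _ => mul_left_comm ..
    _ ≤ 2 ^ (2 * t) * M := by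
      gcongr
      exact (iterate_cfTransfer_le hinv hf n x hx).trans (hmM x hx).2

lemma sum_cfDenom_append_le (hA : ∀ a ∈ A, 1 ≤ a) (ht : 0 ≤ t) {w : List ℕ}
    (hw : ∀ a ∈ w, 1 ≤ a) (n : ℕ) :
    ∑ u ∈ cfWords A n, cfDenom (w ++ u) 0 ^ (-(2 * t)) ≤
      cfDenom w 0 ^ (-(2 * t)) * cfPartition A t n := by
  rw [cfPartition, Finset.mul_sum]
  refine Finset.sum_le_sum fun u hu => ?_
  have hu0 := (cfDenom_pos (one_le_of_mem_cfWords hA hu) (le_refl (0 : ℝ))).le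
  have hmap := cfMap_nonneg u le_rfl
  rw [cfDenom_append, Real.mul_rpow (cfDenom_pos hw hmap).le hu0]
  exact mul_le_mul_of_nonneg_right (cfDenom_rpow_le ht hw hmap) (by positivity)

lemma cfPartition_mul_le (hA : ∀ a ∈ A, 1 ≤ a) (ht : 0 ≤ t) (n m : ℕ) :
    cfPartition A t n * cfPartition A t m ≤ 2 ^ (2 * t) * cfPartition A t (n + m) := by
  simp only [cfPartition]
  rw [sum_cfWords_add, Finset.sum_mul_sum, Finset.mul_sum]
  simp only [Finset.mul_sum]
  refine Finset.sum_le_sum fun w hw => Finset.sum_le_sum fun u hu => ?_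
  have hw1 := one_le_of_mem_cfWords hA hw
  have hu1 := one_le_of_mem_cfWords hA hu
  have hu0 := (cfDenom_pos hu1 (le_refl (0 : ℝ))).le
  have hmap := cfMap_mem_Icc hu1 (left_mem_Icc.2 zero_le_one)
  rw [cfDenom_append, Real.mul_rpow (cfDenom_pos hw1 hmap.1).le hu0, ← mul_assoc]
  gcongr
  exact cfDenom_zero_rpow_le ht hw1 hmap

lemma sum_filter_prefix_le {c : ℝ} (hA : ∀ a ∈ A, 1 ≤ a) (ht : 0 ≤ t) (hc : 0 < c)
    (hZ : ∀ n, c ≤ cfPartition A t n) {w : List ℕ} (hw : ∀ a ∈ w, a ∈ A) {N : ℕ}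
    (hN : w.length ≤ N) :
    ∑ u ∈ cfWords A N with w <+: u, cfDenom u 0 ^ (-(2 * t)) ≤
      cfDenom w 0 ^ (-(2 * t)) * (2 ^ (2 * t) * cfPartition A t N / c) := by
  obtain ⟨m, rfl⟩ := Nat.exists_eq_add_of_le hN
  have hw1 : ∀ a ∈ w, 1 ≤ a := fun a ha => hA a (hw a ha)
  have hw0 := (cfDenom_pos hw1 (le_refl (0 : ℝ))).le
  rw [filter_prefix_cfWords hw, Finset.sum_image (List.append_right_injective w).injOn]
  refine (sum_cfDenom_append_le hA ht hw1 m).trans ?_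
  gcongr
  rw [le_div_iff₀' hc]
  exact (mul_le_mul_of_nonneg_right (hZ _) (cfPartition_nonneg hA m)).trans
    (cfPartition_mul_le hA ht _ _)

lemma le_sum_of_prefix_cover {c : ℝ} (hA : ∀ a ∈ A, 1 ≤ a) (ht : 0 ≤ t) (hc : 0 < c)
    (hZ : ∀ n, c ≤ cfPartition A t n) {ι : Type*} (I : Finset ι) (w : ι → List ℕ)
    (hw : ∀ i ∈ I, ∀ a ∈ w i, a ∈ A) {N : ℕ} (hN : ∀ i ∈ I, (w i).length ≤ N)
    (hcov : ∀ u ∈ cfWords A N, ∃ i ∈ I, w i <+: u) :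
    c / 2 ^ (2 * t) ≤ ∑ i ∈ I, cfDenom (w i) 0 ^ (-(2 * t)) := by
  have hZN : 0 < cfPartition A t N := hc.trans_le (hZ N)
  have hmass : cfPartition A t N ≤
      (∑ i ∈ I, cfDenom (w i) 0 ^ (-(2 * t))) * (2 ^ (2 * t) * cfPartition A t N / c) :=
    calc cfPartition A t N ≤ ∑ u ∈ cfWords A N, ∑ i ∈ I with w i <+: u, cfDenom u 0 ^ (-(2 * t)) :=
          Finset.sum_le_sum fun u hu => by
            obtain ⟨i, hi, hiu⟩ := hcov u hu
            have hpos := cfDenom_pos (one_le_of_mem_cfWords hA hu) (le_refl (0 : ℝ))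
            exact Finset.single_le_sum (f := fun _ => cfDenom u 0 ^ (-(2 * t)))
              (fun _ _ => by positivity) (Finset.mem_filter.2 ⟨hi, hiu⟩)
      _ = ∑ i ∈ I, ∑ u ∈ cfWords A N with w i <+: u, cfDenom u 0 ^ (-(2 * t)) :=
          Finset.sum_comm' fun u i => by simp only [Finset.mem_filter]; tauto
      _ ≤ _ := by
          rw [Finset.sum_mul]
          exact Finset.sum_le_sum fun i hi => sum_filter_prefix_le hA ht hc hZ (hw i hi) (hN i hi)
  rw [div_le_iff₀ (by positivity)]
  refine le_of_mul_le_mul_right ?_ hZN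
  rw [← mul_div_assoc, le_div_iff₀ hc] at hmass
  linarith

end Transfer

/-! ### The coding of the limit set -/

/-- The word formed by the first `n` terms of a sequence. -/
def seqPrefix (a : ℕ → ℕ) (n : ℕ) : List ℕ := (List.range n).map a

@[simp] lemma length_seqPrefix (a : ℕ → ℕ) (n : ℕ) : (seqPrefix a n).length = n := by
  simp [seqPrefix]

lemma seqPrefix_add (a : ℕ → ℕ) (n m : ℕ) :
    seqPrefix a (n + m) = seqPrefix a n ++ seqPrefix (fun k => a (n + k)) m := by
  simp [seqPrefix, List.range_add, Function.comp_def]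

lemma forall_mem_seqPrefix {P : ℕ → Prop} {a : ℕ → ℕ} (ha : ∀ n, P (a n)) (n : ℕ) :
    ∀ b ∈ seqPrefix a n, P b :=
  List.forall_mem_map.2 fun k _ => ha k

lemma seqPrefix_mem_cfWords {A : Finset ℕ} {a : ℕ → ℕ} (ha : ∀ n, a n ∈ A) (n : ℕ) :
    seqPrefix a n ∈ cfWords A n :=
  mem_cfWords.2 ⟨length_seqPrefix a n, forall_mem_seqPrefix (P := (· ∈ A)) ha n⟩

/-- The infinite continued fraction with partial quotients `a 0, a 1, …`. -/
noncomputable def cfLimit (a : ℕ → ℕ) : ℝ := limUnder atTop fun n => cfValue (seqPrefix a n)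

section Coding

variable {a b : ℕ → ℕ}

lemma tendsto_cfLimit (ha : ∀ n, 1 ≤ a n) :
    Tendsto (fun n => cfValue (seqPrefix a n)) atTop (𝓝 (cfLimit a)) := by
  refine CauchySeq.tendsto_limUnder (cauchySeq_of_le_geometric (1 / 2) 2 (by norm_num) fun n => ?_)
  have hprefix := forall_mem_seqPrefix (P := (1 ≤ ·)) ha n
  have hsucc : seqPrefix a (n + 1) = seqPrefix a n ++ [a n] := by
    simp only [seqPrefix, List.range_succ, List.map_append, List.map_singleton]
  have hbranch : cfMap [a n] 0 ∈ Icc (0 : ℝ) 1 := cfBranch_mem_Icc (ha n) le_rfl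
  rw [hsucc, cfValue_eq_cfMap, cfValue_eq_cfMap, cfMap_append, Real.dist_eq]
  refine (abs_cfMap_sub_le hprefix le_rfl hbranch.1).trans ?_
  calc |0 - cfMap [a n] 0| * (cfDenom (seqPrefix a n) 0 ^ 2)⁻¹
      ≤ 1 * (2 * (1 / 2) ^ (seqPrefix a n).length) := by
        gcongr
        · rw [zero_sub, abs_neg, abs_of_nonneg hbranch.1]; exact hbranch.2
        · exact inv_sq_cfDenom_le hprefix
    _ = 2 * (1 / 2) ^ n := by rw [one_mul, length_seqPrefix]

lemma cfLimit_mem_Icc (ha : ∀ n, 1 ≤ a n) : cfLimit a ∈ Icc (0 : ℝ) 1 :=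
  isClosed_Icc.mem_of_tendsto (tendsto_cfLimit ha) (Eventually.of_forall fun n =>
    cfMap_mem_Icc (forall_mem_seqPrefix (P := (1 ≤ ·)) ha n) (left_mem_Icc.2 zero_le_one))

lemma cfLimit_eq_cfMap (ha : ∀ n, 1 ≤ a n) (n : ℕ) :
    cfLimit a = cfMap (seqPrefix a n) (cfLimit fun k => a (n + k)) := by
  have htail : ∀ k, 1 ≤ a (n + k) := fun k => ha _
  have hlim : Tendsto (fun m => cfValue (seqPrefix a (n + m))) atTop (𝓝 (cfLimit a)) := by
    simpa only [add_comm] using (tendsto_add_atTop_iff_nat n).2 (tendsto_cfLimit ha)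
  have hdist := (tendsto_iff_dist_tendsto_zero.1 (tendsto_cfLimit htail)).mul_const
    (cfDenom (seqPrefix a n) 0 ^ 2)⁻¹
  rw [zero_mul] at hdist
  refine tendsto_nhds_unique hlim (tendsto_iff_dist_tendsto_zero.2
    (squeeze_zero (fun _ => dist_nonneg) (fun m => ?_) hdist))
  rw [seqPrefix_add, cfValue_eq_cfMap, cfMap_append]
  exact abs_cfMap_sub_le (forall_mem_seqPrefix (P := (1 ≤ ·)) ha n) (cfMap_nonneg _ le_rfl)
    (cfLimit_mem_Icc htail).1

lemma mem_cfLimitSet_iff {A : Finset ℕ} (hA : ∀ a ∈ A, 1 ≤ a) {x : ℝ} :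
    x ∈ cfLimitSet A ↔ ∃ a : ℕ → ℕ, (∀ n, a n ∈ A) ∧ cfLimit a = x := by
  constructor
  · rintro ⟨a, ha, hx⟩
    exact ⟨a, ha, tendsto_nhds_unique (tendsto_cfLimit fun n => hA _ (ha n)) hx⟩
  · rintro ⟨a, ha, rfl⟩
    exact ⟨a, ha, tendsto_cfLimit fun n => hA _ (ha n)⟩

lemma cfLimit_eq_cfBranch (ha : ∀ n, 1 ≤ a n) :
    cfLimit a = cfBranch (a 0) (cfLimit fun k => a (1 + k)) :=
  cfLimit_eq_cfMap ha 1

lemma one_div_le_cfLimit {B : ℕ} (ha : ∀ n, 1 ≤ a n) (haB : ∀ n, a n ≤ B) :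
    1 / ((B : ℝ) + 1) ≤ cfLimit a := by
  have htail := cfLimit_mem_Icc fun k => ha (1 + k)
  have hpos : (0 : ℝ) < a 0 := by exact_mod_cast ha 0
  have hle : (a 0 : ℝ) ≤ B := by exact_mod_cast haB 0
  rw [cfLimit_eq_cfBranch ha, cfBranch]
  exact one_div_le_one_div_of_le (add_pos_of_nonneg_of_pos htail.1 hpos) (by linarith [htail.2])

lemma le_abs_cfLimit_sub {B : ℕ} (ha : ∀ n, 1 ≤ a n) (haB : ∀ n, a n ≤ B) (hb : ∀ n, 1 ≤ b n)
    (hbB : ∀ n, b n ≤ B) (hab : a 0 ≠ b 0) :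
    1 / ((B : ℝ) + 1) ^ 3 ≤ |cfLimit a - cfLimit b| := by
  have hya := cfLimit_mem_Icc fun k => ha (1 + k)
  have hyb := cfLimit_mem_Icc fun k => hb (1 + k)
  have hya' := one_div_le_cfLimit (fun k => ha (1 + k)) (fun k => haB (1 + k))
  have hyb' := one_div_le_cfLimit (fun k => hb (1 + k)) (fun k => hbB (1 + k))
  rw [cfLimit_eq_cfBranch ha, cfLimit_eq_cfBranch hb, cfBranch, cfBranch]
  set y := cfLimit fun k => a (1 + k)
  set z := cfLimit fun k => b (1 + k)
  have ha1 : (1 : ℝ) ≤ a 0 := by exact_mod_cast ha 0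
  have hb1 : (1 : ℝ) ≤ b 0 := by exact_mod_cast hb 0
  have haB' : (a 0 : ℝ) ≤ B := by exact_mod_cast haB 0
  have hbB' : (b 0 : ℝ) ≤ B := by exact_mod_cast hbB 0
  have hpos : 0 < (y + a 0) * (z + b 0) :=
    mul_pos (by linarith [hya.1]) (by linarith [hyb.1])
  have hgap : 1 / ((B : ℝ) + 1) ≤ |(z + b 0) - (y + a 0)| := by
    rcases lt_or_gt_of_ne hab with hlt | hlt
    · have : (a 0 : ℝ) + 1 ≤ b 0 := by exact_mod_cast hlt
      exact le_abs.2 (Or.inl (by linarith [hya.2]))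
    · have : (b 0 : ℝ) + 1 ≤ a 0 := by exact_mod_cast hlt
      exact le_abs.2 (Or.inr (by linarith [hyb.2]))
  have hsub : 1 / (y + a 0) - 1 / (z + b 0) =
      ((z + b 0) - (y + a 0)) / ((y + a 0) * (z + b 0)) := by
    have := left_ne_zero_of_mul hpos.ne'
    have := right_ne_zero_of_mul hpos.ne'
    field_simp
  rw [hsub, abs_div, abs_of_pos hpos, pow_succ', ← div_div, sq]
  exact div_le_div₀ (abs_nonneg _) hgap hpos (mul_le_mul (by linarith [hya.2]) (by linarith [hyb.2])
    (by linarith [hyb.1]) (by positivity))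

lemma inv_sq_cfDenom_le_mul_abs_cfLimit_sub {B : ℕ} (ha : ∀ n, 1 ≤ a n) (haB : ∀ n, a n ≤ B)
    (hb : ∀ n, 1 ≤ b n) (hbB : ∀ n, b n ≤ B) {n : ℕ} (hprefix : seqPrefix a n = seqPrefix b n)
    (hab : a n ≠ b n) :
    (cfDenom (seqPrefix a n) 0 ^ 2)⁻¹ ≤ 4 * ((B : ℝ) + 1) ^ 3 * |cfLimit a - cfLimit b| := by
  have hw := forall_mem_seqPrefix (P := (1 ≤ ·)) ha n
  have hsep := le_abs_cfLimit_sub (fun k => ha (n + k)) (fun k => haB (n + k))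
    (fun k => hb (n + k)) (fun k => hbB (n + k)) hab
  have hle := le_abs_cfMap_sub hw (cfLimit_mem_Icc fun k => ha (n + k))
    (cfLimit_mem_Icc fun k => hb (n + k))
  have hD := cfDenom_pos hw le_rfl
  have hpos : 0 < ((cfDenom (seqPrefix a n) 0 ^ 2)⁻¹ : ℝ) := by positivity
  rw [mul_inv] at hle
  rw [div_le_iff₀ (by positivity)] at hsep
  rw [cfLimit_eq_cfMap ha n, cfLimit_eq_cfMap hb n, ← hprefix]
  calc (cfDenom (seqPrefix a n) 0 ^ 2)⁻¹
      ≤ |(cfLimit fun k => a (n + k)) - cfLimit fun k => b (n + k)| * ((B : ℝ) + 1) ^ 3 *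
          (cfDenom (seqPrefix a n) 0 ^ 2)⁻¹ := le_mul_of_one_le_left hpos.le hsep
    _ = 4 * ((B : ℝ) + 1) ^ 3 * (|(cfLimit fun k => a (n + k)) - cfLimit fun k => b (n + k)| *
          (4⁻¹ * (cfDenom (seqPrefix a n) 0 ^ 2)⁻¹)) := by ring
    _ ≤ _ := by gcongr

end Coding

lemma subsingleton_or_exists_first_ne {α : Type*} (S : Set (ℕ → α)) :
    S.Subsingleton ∨ ∃ n, (∃ a ∈ S, ∃ b ∈ S, a n ≠ b n) ∧
      ∀ c ∈ S, ∀ d ∈ S, ∀ k < n, c k = d k := by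
  classical
  rw [or_iff_not_imp_left, not_subsingleton_iff]
  rintro ⟨a, ha, b, hb, hab⟩
  have hex : ∃ n, ∃ a ∈ S, ∃ b ∈ S, a n ≠ b n := by
    obtain ⟨n, hn⟩ := Function.ne_iff.1 hab
    exact ⟨n, a, ha, b, hb, hn⟩
  refine ⟨Nat.find hex, Nat.find_spec hex, fun c hc d hd k hk => ?_⟩
  by_contra hne
  exact Nat.find_min hex hk ⟨c, hc, d, hd, hne⟩

/-! ### Hausdorff dimension and the growth of the partition function -/

lemma ofReal_cfDenom_rpow {t : ℝ} (ht : 0 ≤ t) {l : List ℕ} (hl : ∀ a ∈ l, 1 ≤ a) :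
    ENNReal.ofReal (cfDenom l 0 ^ (-(2 * t))) = ENNReal.ofReal ((cfDenom l 0 ^ 2)⁻¹) ^ t := by
  have hD := cfDenom_pos hl le_rfl
  rw [ENNReal.ofReal_rpow_of_nonneg (by positivity) ht, Real.inv_rpow (by positivity),
    ← Real.rpow_natCast, ← Real.rpow_mul hD.le, Real.rpow_neg hD.le, Nat.cast_ofNat]

lemma ediam_image_cfMap_le {l : List ℕ} (hl : ∀ a ∈ l, 1 ≤ a) :
    Metric.ediam (cfMap l '' Icc 0 1) ≤ ENNReal.ofReal ((cfDenom l 0 ^ 2)⁻¹) := by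
  refine Metric.ediam_le ?_
  rintro _ ⟨x, hx, rfl⟩ _ ⟨y, hy, rfl⟩
  rw [edist_dist, Real.dist_eq]
  refine ENNReal.ofReal_le_ofReal ((abs_cfMap_sub_le hl hx.1 hy.1).trans ?_)
  exact mul_le_of_le_one_left (by positivity) (Real.dist_le_of_mem_Icc_01 hx hy)

lemma sum_ediam_rpow_le_cfPartition {A : Finset ℕ} (hA : ∀ a ∈ A, 1 ≤ a) {t : ℝ} (ht : 0 ≤ t)
    (n : ℕ) :
    ∑ l : cfWords A n, Metric.ediam (cfMap l '' Icc 0 1) ^ t ≤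
      ENNReal.ofReal (cfPartition A t n) := by
  rw [Finset.sum_coe_sort (cfWords A n) fun l => Metric.ediam (cfMap l '' Icc 0 1) ^ t, cfPartition,
    ENNReal.ofReal_sum_of_nonneg fun l hl =>
      Real.rpow_nonneg (cfDenom_pos (one_le_of_mem_cfWords hA hl) le_rfl).le _]
  refine Finset.sum_le_sum fun l hl => ?_
  have hl1 := one_le_of_mem_cfWords hA hl
  rw [ofReal_cfDenom_rpow ht hl1]
  exact ENNReal.rpow_le_rpow (ediam_image_cfMap_le hl1) ht

theorem dimH_cfLimitSet_le {A : Finset ℕ} (hA : ∀ a ∈ A, 1 ≤ a) {t C : ℝ} (ht : 0 ≤ t)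
    (hZ : ∀ n, cfPartition A t n ≤ C) : dimH (cfLimitSet A) ≤ ENNReal.ofReal t := by
  have hmesh : Tendsto (fun n : ℕ => ENNReal.ofReal (2 * (1 / 2 : ℝ) ^ n)) atTop (𝓝 0) := by
    rw [← ENNReal.ofReal_zero, ← mul_zero (2 : ℝ)]
    exact ENNReal.tendsto_ofReal ((tendsto_pow_atTop_nhds_zero_of_lt_one (by norm_num)
      (by norm_num)).const_mul 2)
  have hdiam (n : ℕ) (l : cfWords A n) :
      Metric.ediam (cfMap l '' Icc 0 1) ≤ ENNReal.ofReal (2 * (1 / 2 : ℝ) ^ n) := by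
    have hl1 := one_le_of_mem_cfWords hA l.2
    refine (ediam_image_cfMap_le hl1).trans (ENNReal.ofReal_le_ofReal ?_)
    simpa only [(mem_cfWords.1 l.2).1] using inv_sq_cfDenom_le hl1
  have hcover (n : ℕ) : cfLimitSet A ⊆ ⋃ l : cfWords A n, cfMap l '' Icc 0 1 := by
    intro x hx
    obtain ⟨a, ha, rfl⟩ := (mem_cfLimitSet_iff hA).1 hx
    exact mem_iUnion.2 ⟨⟨_, seqPrefix_mem_cfWords ha n⟩, _,
      cfLimit_mem_Icc fun k => hA _ (ha (n + k)), (cfLimit_eq_cfMap (fun k => hA _ (ha k)) n).symm⟩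
  have hmeasure : MeasureTheory.Measure.hausdorffMeasure t (cfLimitSet A) ≤ ENNReal.ofReal C :=
    calc _ ≤ liminf (fun n => ∑ l : cfWords A n, Metric.ediam (cfMap l '' Icc 0 1) ^ t) atTop :=
          MeasureTheory.Measure.hausdorffMeasure_le_liminf_sum t _ _ hmesh
            (fun n (l : cfWords A n) => cfMap l '' Icc 0 1) (Eventually.of_forall hdiam)
            (Eventually.of_forall hcover)
      _ ≤ liminf (fun _ : ℕ => ENNReal.ofReal C) atTop :=
          liminf_le_liminf (Eventually.of_forall fun n =>
            (sum_ediam_rpow_le_cfPartition hA ht n).trans (ENNReal.ofReal_le_ofReal (hZ n)))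
      _ = ENNReal.ofReal C := liminf_const _
  rw [← Real.coe_toNNReal t ht] at hmeasure
  exact dimH_le_of_hausdorffMeasure_ne_top (ne_top_of_le_ne_top ENNReal.ofReal_ne_top hmeasure)

lemma exists_cfDenom_seqPrefix_rpow_le {a : ℕ → ℕ} (ha : ∀ n, 1 ≤ a n) {t : ℝ} (ht : 0 < t)
    {ε : ℝ≥0} (hε : 0 < ε) :
    ∃ n, ENNReal.ofReal (cfDenom (seqPrefix a n) 0 ^ (-(2 * t))) ≤ ε := by
  have hlim : Tendsto (fun n : ℕ => ENNReal.ofReal (2 * (1 / 2 : ℝ) ^ n) ^ t) atTop (𝓝 0) := by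
    rw [← ENNReal.zero_rpow_of_pos ht, ← ENNReal.ofReal_zero, ← mul_zero (2 : ℝ)]
    exact (ENNReal.tendsto_ofReal ((tendsto_pow_atTop_nhds_zero_of_lt_one (by norm_num)
      (by norm_num)).const_mul 2)).ennrpow_const t
  obtain ⟨n, hn⟩ := (hlim.eventually_le_const (ENNReal.coe_pos.2 hε)).exists
  refine ⟨n, le_trans ?_ hn⟩
  have hw := forall_mem_seqPrefix (P := (1 ≤ ·)) ha n
  rw [ofReal_cfDenom_rpow ht.le hw]
  gcongr
  simpa only [length_seqPrefix] using inv_sq_cfDenom_le hw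

/-- The word is the longest common prefix of the codings of the points of `U`; if there is at most
one coding, that prefix is infinite or undefined, and a long finite word costs the error `ε`. -/
lemma exists_word_of_set {A : Finset ℕ} {B : ℕ} (hA : ∀ a ∈ A, 1 ≤ a) (hB : ∀ a ∈ A, a ≤ B)
    (hne : A.Nonempty) {t : ℝ} (ht : 0 < t) (U : Set ℝ) {ε : ℝ≥0} (hε : 0 < ε) :
    ∃ w : List ℕ, (∀ a ∈ w, a ∈ A) ∧
      (∀ a : ℕ → ℕ, (∀ n, a n ∈ A) → cfLimit a ∈ U → seqPrefix a w.length = w) ∧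
      ENNReal.ofReal (cfDenom w 0 ^ (-(2 * t))) ≤
        ENNReal.ofReal (4 * ((B : ℝ) + 1) ^ 3) ^ t * Metric.ediam U ^ t + ε := by
  have hA1 {a : ℕ → ℕ} (ha : ∀ n, a n ∈ A) (n : ℕ) : 1 ≤ a n := hA _ (ha n)
  have hAB {a : ℕ → ℕ} (ha : ∀ n, a n ∈ A) (n : ℕ) : a n ≤ B := hB _ (ha n)
  rcases subsingleton_or_exists_first_ne {a : ℕ → ℕ | (∀ n, a n ∈ A) ∧ cfLimit a ∈ U} with
    hsub | ⟨n, ⟨a, ⟨ha, haU⟩, b, ⟨hb, hbU⟩, hab⟩, hagree⟩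
  · obtain ⟨a, ha, hcode⟩ : ∃ a : ℕ → ℕ, (∀ n, a n ∈ A) ∧
        ∀ b : ℕ → ℕ, (∀ n, b n ∈ A) → cfLimit b ∈ U → b = a := by
      by_cases hU : ∃ a : ℕ → ℕ, (∀ n, a n ∈ A) ∧ cfLimit a ∈ U
      · obtain ⟨a, ha, haU⟩ := hU
        exact ⟨a, ha, fun b hb hbU => hsub ⟨hb, hbU⟩ ⟨ha, haU⟩⟩
      · obtain ⟨a₀, ha₀⟩ := hne
        exact ⟨fun _ => a₀, fun _ => ha₀, fun b hb hbU => absurd ⟨b, hb, hbU⟩ hU⟩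
    obtain ⟨n, hn⟩ := exists_cfDenom_seqPrefix_rpow_le (hA1 ha) ht hε
    refine ⟨seqPrefix a n, forall_mem_seqPrefix (P := (· ∈ A)) ha n, fun b hb hbU => ?_,
      le_add_left hn⟩
    rw [length_seqPrefix, hcode b hb hbU]
  · have hprefix (c) (hc : ∀ n, c n ∈ A) (hcU : cfLimit c ∈ U) : seqPrefix c n = seqPrefix a n :=
      List.map_congr_left fun k hk => hagree c ⟨hc, hcU⟩ a ⟨ha, haU⟩ k (List.mem_range.1 hk)
    refine ⟨seqPrefix a n, forall_mem_seqPrefix (P := (· ∈ A)) ha n, fun c hc hcU => ?_,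
      le_add_right ?_⟩
    · rw [length_seqPrefix, hprefix c hc hcU]
    · rw [ofReal_cfDenom_rpow ht.le (forall_mem_seqPrefix (P := (1 ≤ ·)) (hA1 ha) n),
        ← ENNReal.mul_rpow_of_nonneg _ _ ht.le]
      gcongr
      refine (ENNReal.ofReal_le_ofReal (inv_sq_cfDenom_le_mul_abs_cfLimit_sub (hA1 ha) (hAB ha)
        (hA1 hb) (hAB hb) (hprefix b hb hbU).symm hab)).trans ?_
      rw [ENNReal.ofReal_mul (by positivity), ← Real.dist_eq, ← edist_dist]
      gcongr
      exact Metric.edist_le_ediam_of_mem haU hbU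

lemma isOpen_setOf_seqPrefix_eq (A : Finset ℕ) (w : List ℕ) :
    IsOpen {a : ℕ → A | seqPrefix (fun n => (a n : ℕ)) w.length = w} := by
  have hcont : Continuous fun (a : ℕ → A) (k : Fin w.length) => a k := by fun_prop
  have hofFn (a : ℕ → A) :
      seqPrefix (fun n => (a n : ℕ)) w.length = List.ofFn fun k : Fin w.length => (a k : ℕ) :=
    List.ext_getElem (by simp) (by simp [seqPrefix])
  simp only [hofFn]
  exact (isOpen_discrete {v : Fin w.length → A | (List.ofFn fun k => (v k : ℕ)) = w}).preimage hcont

lemma seqPrefix_getD {u : List ℕ} {n : ℕ} (hn : n ≤ u.length) (d : ℕ) :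
    seqPrefix (fun k => u.getD k d) n = u.take n := by
  refine List.ext_getElem (by simpa using hn) fun k hk _ => ?_
  have hk' : k < u.length := (by simpa using hk : k < n).trans_le hn
  simp [seqPrefix, hk']

lemma exists_finite_prefix_cover {A : Finset ℕ} (hne : A.Nonempty) {ι : Type*} (w : ι → List ℕ)
    (hcov : ∀ a : ℕ → ℕ, (∀ n, a n ∈ A) → ∃ i, seqPrefix a (w i).length = w i) :
    ∃ I : Finset ι, ∃ N : ℕ, (∀ i ∈ I, (w i).length ≤ N) ∧
      ∀ u ∈ cfWords A N, ∃ i ∈ I, w i <+: u := by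
  obtain ⟨I, hI⟩ := isCompact_univ.elim_finite_subcover _
    (fun i => isOpen_setOf_seqPrefix_eq A (w i)) fun a _ =>
    mem_iUnion.2 (hcov (fun n => a n) fun n => (a n).2)
  have hlen : ∀ i ∈ I, (w i).length ≤ I.sup fun i => (w i).length := fun i hi =>
    Finset.le_sup (f := fun i => (w i).length) hi
  obtain ⟨a₀, ha₀⟩ := hne
  refine ⟨I, _, hlen, fun u hu => ?_⟩
  obtain ⟨hulen, huA⟩ := mem_cfWords.1 hu
  have hmem (k : ℕ) : u.getD k a₀ ∈ A := by
    rcases lt_or_ge k u.length with hk | hk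
    · rw [List.getD_eq_getElem _ _ hk]; exact huA _ (List.getElem_mem hk)
    · rw [List.getD_eq_default _ _ hk]; exact ha₀
  obtain ⟨i, hi, hiu⟩ : ∃ i ∈ I, seqPrefix (fun k => u.getD k a₀) (w i).length = w i := by
    simpa using hI (mem_univ fun k => ⟨u.getD k a₀, hmem k⟩)
  refine ⟨i, hi, ?_⟩
  rw [← hiu, seqPrefix_getD (hulen ▸ hlen i hi)]
  exact List.take_prefix _ _

lemma ofReal_le_mul_tsum_ediam {A : Finset ℕ} {B : ℕ} (hA : ∀ a ∈ A, 1 ≤ a)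
    (hB : ∀ a ∈ A, a ≤ B) (hne : A.Nonempty) {t c : ℝ} (ht : 0 < t) (hc : 0 < c)
    (hZ : ∀ n, c ≤ cfPartition A t n) {U : ℕ → Set ℝ} (hU : cfLimitSet A ⊆ ⋃ i, U i) :
    ENNReal.ofReal (c / 2 ^ (2 * t)) ≤
      ENNReal.ofReal (4 * ((B : ℝ) + 1) ^ 3) ^ t * ∑' i, Metric.ediam (U i) ^ t := by
  refine ENNReal.le_of_forall_pos_le_add fun ε hε _ => ?_
  obtain ⟨δ, hδ, hδsum⟩ := ENNReal.exists_pos_sum_of_countable (ENNReal.coe_pos.2 hε).ne' ℕ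
  choose w hwA hwU hw using fun i => exists_word_of_set hA hB hne ht (U i) (hδ i)
  obtain ⟨I, N, hN, hcov⟩ := exists_finite_prefix_cover hne w fun a ha => by
    obtain ⟨i, hi⟩ := mem_iUnion.1 (hU ((mem_cfLimitSet_iff hA).2 ⟨a, ha, rfl⟩))
    exact ⟨i, hwU i a ha hi⟩
  set K := ENNReal.ofReal (4 * ((B : ℝ) + 1) ^ 3) ^ t
  calc ENNReal.ofReal (c / 2 ^ (2 * t))
      ≤ ENNReal.ofReal (∑ i ∈ I, cfDenom (w i) 0 ^ (-(2 * t))) := ENNReal.ofReal_le_ofReal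
        (le_sum_of_prefix_cover hA ht.le hc hZ I w (fun i _ => hwA i) hN hcov)
    _ = ∑ i ∈ I, ENNReal.ofReal (cfDenom (w i) 0 ^ (-(2 * t))) :=
        ENNReal.ofReal_sum_of_nonneg fun i _ =>
          Real.rpow_nonneg (cfDenom_pos (fun a ha => hA a (hwA i a ha)) le_rfl).le _
    _ ≤ ∑ i ∈ I, (K * Metric.ediam (U i) ^ t + δ i) := Finset.sum_le_sum fun i _ => hw i
    _ ≤ ∑' i, (K * Metric.ediam (U i) ^ t + δ i) := ENNReal.sum_le_tsum I
    _ = K * ∑' i, Metric.ediam (U i) ^ t + ∑' i, (δ i : ℝ≥0∞) := by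
        rw [ENNReal.tsum_add, ENNReal.tsum_mul_left]
    _ ≤ _ := by gcongr

theorem le_dimH_cfLimitSet {A : Finset ℕ} (hA : ∀ a ∈ A, 1 ≤ a) {t c : ℝ} (ht : 0 < t)
    (hc : 0 < c) (hZ : ∀ n, c ≤ cfPartition A t n) :
    ENNReal.ofReal t ≤ dimH (cfLimitSet A) := by
  have hne : A.Nonempty := by
    by_contra hempty
    have h1 := hZ 1
    rw [Finset.not_nonempty_iff_eq_empty.1 hempty] at h1
    simp only [cfPartition, cfWords, Finset.empty_product, Finset.image_empty,
      Finset.sum_empty] at h1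
    linarith
  have hmeasure : MeasureTheory.Measure.hausdorffMeasure t (cfLimitSet A) ≠ 0 := by
    intro hzero
    set K := ENNReal.ofReal (4 * (((A.sup id : ℕ) : ℝ) + 1) ^ 3) ^ t
    have hK : K ≠ ∞ := ENNReal.rpow_ne_top_of_nonneg ht.le ENNReal.ofReal_ne_top
    have hle : ENNReal.ofReal (c / 2 ^ (2 * t)) / K ≤
        MeasureTheory.Measure.hausdorffMeasure t (cfLimitSet A) := by
      rw [MeasureTheory.Measure.hausdorffMeasure_apply]
      refine le_iSup₂_of_le 1 one_pos (le_iInf fun U => le_iInf fun hU => le_iInf fun _ => ?_)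
      refine ENNReal.div_le_of_le_mul' ((ofReal_le_mul_tsum_ediam hA
        (fun a ha => Finset.le_sup (f := id) ha) hne ht hc hZ hU).trans ?_)
      gcongr with i
      rcases (U i).eq_empty_or_nonempty with hempty | hnonempty
      · simp [hempty, ENNReal.zero_rpow_of_pos ht]
      · simp [hnonempty]
    rw [hzero, nonpos_iff_eq_zero, ENNReal.div_eq_zero_iff, ENNReal.ofReal_eq_zero] at hle
    exact hle.elim (fun h => absurd h (not_le.2 (by positivity))) hK
  rw [← Real.coe_toNNReal t ht.le] at hmeasure
  exact le_dimH_of_hausdorffMeasure_ne_zero hmeasure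

/-! ### Test functions -/

section TestFunction

variable {A : Finset ℕ} {t m M : ℝ} {f : ℝ → ℝ} {J : Set ℝ}

theorem le_dimH_of_le_cfTransfer (hA : ∀ a ∈ A, 1 ≤ a) (ht : 0 < t) (hJ : J ⊆ Icc 0 1)
    (hJne : J.Nonempty) (hinv : ∀ a ∈ A, ∀ x ∈ J, cfBranch a x ∈ J) (hm : 0 < m)
    (hmM : ∀ x ∈ J, f x ∈ Icc m M) (hf : ∀ x ∈ J, f x ≤ cfTransfer A t f x) :
    ENNReal.ofReal t ≤ dimH (cfLimitSet A) := by
  have hM : 0 < M := by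
    obtain ⟨x, hx⟩ := hJne
    exact hm.trans_le ((hmM x hx).1.trans (hmM x hx).2)
  exact le_dimH_cfLimitSet hA ht (div_pos hm hM)
    (div_le_cfPartition hA ht.le hJ hJne hinv hm hmM hf)

theorem dimH_le_of_cfTransfer_le (hA : ∀ a ∈ A, 1 ≤ a) (ht : 0 ≤ t) (hJ : J ⊆ Icc 0 1)
    (hJne : J.Nonempty) (hinv : ∀ a ∈ A, ∀ x ∈ J, cfBranch a x ∈ J) (hm : 0 < m)
    (hmM : ∀ x ∈ J, f x ∈ Icc m M) (hf : ∀ x ∈ J, cfTransfer A t f x ≤ f x) :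
    dimH (cfLimitSet A) ≤ ENNReal.ofReal t :=
  dimH_cfLimitSet_le hA ht (cfPartition_le hA ht hJ hJne hinv hm hmM hf)

lemma mul_cfTransfer_le_cfTransfer (hA : ∀ a ∈ A, 1 ≤ a) {K t' x : ℝ} (hx : 0 ≤ x)
    (hf : ∀ a ∈ A, 0 ≤ f (cfBranch a x)) (hK : ∀ a ∈ A, K ≤ (x + a) ^ (2 * (t - t'))) :
    K * cfTransfer A t f x ≤ cfTransfer A t' f x := by
  rw [cfTransfer_eq hA _ _ hx, cfTransfer_eq hA _ _ hx, Finset.mul_sum]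
  refine Finset.sum_le_sum fun a ha => ?_
  have hpos : 0 < x + a := cfMap_add_pos (hA a ha) [] hx
  have hf0 := hf a ha
  calc K * (f (cfBranch a x) * (x + a) ^ (-(2 * t)))
      ≤ (x + a) ^ (2 * (t - t')) * (f (cfBranch a x) * (x + a) ^ (-(2 * t))) := by
        gcongr
        exact hK a ha
    _ = f (cfBranch a x) * (x + a) ^ (-(2 * t')) := by
        rw [mul_left_comm, ← Real.rpow_add hpos]
        ring_nf

lemma iInf_mul_le_cfTransfer (hpos : ∀ x ∈ Icc (0 : ℝ) 1, 0 < f x)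
    (h : 0 < ⨅ x : Icc (0 : ℝ) 1, cfTransfer A t f x / f x) {x : ℝ} (hx : x ∈ Icc (0 : ℝ) 1) :
    (⨅ x : Icc (0 : ℝ) 1, cfTransfer A t f x / f x) * f x ≤ cfTransfer A t f x := by
  have hbdd : BddBelow (range fun x : Icc (0 : ℝ) 1 => cfTransfer A t f x / f x) := by
    by_contra hcon
    rw [Real.iInf_of_not_bddBelow hcon] at h
    exact h.false
  rw [← le_div_iff₀ (hpos x hx)]
  exact ciInf_le hbdd ⟨x, hx⟩

/-- A gap in `f ≤ L_t f` is spent on raising `t`: the weights `(x + a)^(-2t)` are bounded below,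
so `f ≤ L_{t + η} f` for some `η > 0`. -/
theorem lt_dimH_of_one_lt_iInf (hA : ∀ a ∈ A, 1 ≤ a) (ht : 0 ≤ t)
    (hf : ContinuousOn f (Icc 0 1)) (hpos : ∀ x ∈ Icc (0 : ℝ) 1, 0 < f x)
    (h : 1 < ⨅ x : Icc (0 : ℝ) 1, cfTransfer A t f x / f x) :
    ENNReal.ofReal t < dimH (cfLimitSet A) := by
  set c := ⨅ x : Icc (0 : ℝ) 1, cfTransfer A t f x / f x
  have hc0 : 0 < c := zero_lt_one.trans h
  have hinv : ∀ a ∈ A, ∀ x ∈ Icc (0 : ℝ) 1, cfBranch a x ∈ Icc (0 : ℝ) 1 := fun a ha x hx =>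
    cfBranch_mem_Icc (hA a ha) hx.1
  have hne : (Icc (0 : ℝ) 1).Nonempty := nonempty_Icc.2 zero_le_one
  obtain ⟨y, hy, hmin⟩ := isCompact_Icc.exists_isMinOn hne hf
  obtain ⟨z, -, hmax⟩ := isCompact_Icc.exists_isMaxOn hne hf
  set b : ℝ := (A.sup id : ℕ) + 2
  have hb1 : 1 < b := by
    have : (0 : ℝ) ≤ (A.sup id : ℕ) := Nat.cast_nonneg _
    linarith
  have hb : ∀ a ∈ A, ∀ x ∈ Icc (0 : ℝ) 1, x + a ≤ b := fun a ha x hx => by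
    have : (a : ℝ) ≤ (A.sup id : ℕ) := Nat.cast_le.2 (Finset.le_sup (f := id) ha)
    linarith [hx.2]
  set η := Real.logb b c / 2 with hη
  have hη0 : 0 < η := half_pos (Real.logb_pos hb1 h)
  have hbη : b ^ (2 * (t - (t + η))) = c⁻¹ := by
    rw [show 2 * (t - (t + η)) = -Real.logb b c by rw [hη]; ring, Real.rpow_neg (by positivity),
      Real.rpow_logb (by positivity) hb1.ne' hc0]
  have hle : ENNReal.ofReal (t + η) ≤ dimH (cfLimitSet A) := by
    refine le_dimH_of_le_cfTransfer hA (by positivity) Subset.rfl hne hinv (hpos y hy)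
      (fun x hx => ⟨hmin hx, hmax hx⟩) fun x hx => ?_
    refine ((le_inv_mul_iff₀ hc0).2 (iInf_mul_le_cfTransfer hpos hc0 hx)).trans
      (mul_cfTransfer_le_cfTransfer hA hx.1 (fun a ha => (hpos _ (hinv a ha x hx)).le)
        fun a ha => ?_)
    rw [← hbη]
    exact Real.rpow_le_rpow_of_nonpos (cfMap_add_pos (hA a ha) [] hx.1) (hb a ha x hx) (by linarith)
  exact lt_of_lt_of_le ((ENNReal.ofReal_lt_ofReal_iff (by positivity)).2 (by linarith)) hle

end TestFunction

lemma IsPositiveHolder.continuousOn {f : ℝ → ℝ} (hf : IsPositiveHolder f) :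
    ContinuousOn f (Icc 0 1) := by
  obtain ⟨⟨C, α, hα, -, hC⟩, -⟩ := hf
  exact hC.continuousOn hα

/-! ### The binomial series with remainder -/

/-- The coefficients `a (a + 1) ⋯ (a + n - 1) / n!` of the series of `(1 - v) ^ (-a)`; the recursive
form can be evaluated over `ℚ`. -/
def risingCoeff {K : Type*} [Field K] (a : K) : ℕ → K
  | 0 => 1
  | n + 1 => risingCoeff a n * (a + n) / (n + 1)

lemma cast_risingCoeff (a : ℚ) (n : ℕ) :
    ((risingCoeff a n : ℚ) : ℝ) = risingCoeff (a : ℝ) n := by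
  induction n with
  | zero => exact Rat.cast_one
  | succ n ih => rw [risingCoeff, risingCoeff, ← ih]; push_cast; rfl

lemma risingCoeff_nonneg {σ : ℝ} (hσ : 0 ≤ σ) (n : ℕ) : 0 ≤ risingCoeff σ n := by
  induction n with
  | zero => exact zero_le_one
  | succ n ih => rw [risingCoeff]; positivity

lemma risingCoeff_add_le {σ : ℝ} {J : ℕ} (hσ : 0 ≤ σ) (hJ : σ ≤ J + 2) (i : ℕ) :
    risingCoeff σ (i + J) ≤ risingCoeff σ J * 2 ^ i := by
  induction i with
  | zero => simp
  | succ i ih =>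
    have hratio : (σ + (i + J : ℕ)) / ((i + J : ℕ) + 1) ≤ 2 := by
      rw [div_le_iff₀ (by positivity)]
      push_cast
      have : (0 : ℝ) ≤ i := Nat.cast_nonneg _
      have : (0 : ℝ) ≤ J := Nat.cast_nonneg _
      linarith
    have hJ0 := risingCoeff_nonneg hσ J
    rw [Nat.add_right_comm, risingCoeff, mul_div_assoc, pow_succ, ← mul_assoc]
    gcongr

lemma choose_neg_eq_risingCoeff (σ : ℝ) (n : ℕ) :
    Ring.choose (-σ) n = (-1) ^ n * risingCoeff σ n := by
  rw [Ring.choose_eq_smul, smul_eq_mul, inv_mul_eq_iff_eq_mul₀ (by positivity)]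
  induction n with
  | zero => simp [risingCoeff]
  | succ n ih =>
    have hX : (Polynomial.X - (n : Polynomial ℤ)).smeval (-σ) = -σ - n := by
      simp [Polynomial.smeval_sub, Polynomial.smeval_natCast]
    rw [risingCoeff, descPochhammer_succ_right, Polynomial.smeval_mul, Nat.factorial_succ, hX, ih]
    push_cast
    field_simp
    ring

lemma hasSum_one_add_rpow_neg (σ : ℝ) {v : ℝ} (hv : |v| < 1) :
    HasSum (fun j : ℕ => (-1) ^ j * risingCoeff σ j * v ^ j) ((1 + v) ^ (-σ)) := by
  have h := (Real.one_add_rpow_hasFPowerSeriesOnBall_zero (a := -σ)).hasSum (y := v) (by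
    simpa [Metric.mem_eball, edist_dist, Real.dist_eq] using hv)
  rw [zero_add] at h
  refine h.congr_fun fun j => ?_
  rw [binomialSeries_apply, choose_neg_eq_risingCoeff, List.ofFn_const, List.prod_replicate,
    smul_eq_mul]

lemma abs_one_add_rpow_sub_le {σ v : ℝ} {J : ℕ} (hσ : 0 ≤ σ) (hJ : σ ≤ J + 2) (hv : |v| ≤ 1 / 4) :
    |(1 + v) ^ (-σ) - ∑ j ∈ Finset.range J, (-1) ^ j * risingCoeff σ j * v ^ j| ≤
      2 * risingCoeff σ J * |v| ^ J := by
  have htail := (hasSum_nat_add_iff' J).2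
    (hasSum_one_add_rpow_neg σ (hv.trans_lt (by norm_num) : |v| < 1))
  have hgeom : HasSum (fun i : ℕ => risingCoeff σ J * |v| ^ J * (1 / 2) ^ i)
      (risingCoeff σ J * |v| ^ J * 2) := hasSum_geometric_two.mul_left _
  have hterm (i : ℕ) : ‖(-1) ^ (i + J) * risingCoeff σ (i + J) * v ^ (i + J)‖ ≤
      risingCoeff σ J * |v| ^ J * (1 / 2) ^ i := by
    have hJ0 := risingCoeff_nonneg hσ J
    calc ‖(-1) ^ (i + J) * risingCoeff σ (i + J) * v ^ (i + J)‖
        = risingCoeff σ (i + J) * (|v| ^ i * |v| ^ J) := by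
          rw [norm_mul, norm_mul, norm_pow, norm_pow, norm_neg, norm_one, one_pow, one_mul,
            Real.norm_eq_abs, Real.norm_eq_abs, abs_of_nonneg (risingCoeff_nonneg hσ _), pow_add]
      _ ≤ (risingCoeff σ J * 2 ^ i) * ((1 / 4) ^ i * |v| ^ J) := by
          gcongr
          exact risingCoeff_add_le hσ hJ i
      _ = risingCoeff σ J * |v| ^ J * (1 / 2) ^ i := by
          rw [show (1 / 2 : ℝ) = 2 * (1 / 4) by norm_num, mul_pow]
          ring
  have hnorm := htail.norm_le_of_bounded hgeom hterm
  rwa [Real.norm_eq_abs, mul_comm _ (2 : ℝ), ← mul_assoc] at hnorm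

/-! ### Power series of the transfer operator on polynomials -/

lemma sum_mul_add_pow_eq {R : Type*} [CommSemiring R] (c : ℕ → R) {N J : ℕ} (hNJ : N ≤ J)
    (z u : R) :
    ∑ k ∈ Finset.range N, c k * (z + u) ^ k =
      ∑ j ∈ Finset.range J, (∑ k ∈ Finset.range N, c k * k.choose j * z ^ (k - j)) * u ^ j := by
  simp only [Finset.sum_mul]
  rw [Finset.sum_comm]
  refine Finset.sum_congr rfl fun k hk => ?_
  rw [add_comm, add_pow, Finset.mul_sum]
  have hkJ : k + 1 ≤ J := (Finset.mem_range.1 hk).trans_le hNJ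
  rw [← Finset.sum_subset (Finset.range_subset_range.2 hkJ) fun j _ hj => ?_]
  · exact Finset.sum_congr rfl fun j _ => by ring
  · rw [Finset.mem_range, not_lt] at hj
    rw [Nat.choose_eq_zero_of_lt hj, Nat.cast_zero, mul_zero, zero_mul, zero_mul]

lemma abs_one_add_div_rpow_mul_inv_pow_sub_le {σ X u : ℝ} {k J : ℕ} (hσ : 0 ≤ σ)
    (hJ : k + σ ≤ J + 2) (hX : 0 < X) (hu : |u| ≤ X / 4) :
    |(1 + u / X) ^ (-σ) * (X + u)⁻¹ ^ k -
        ∑ j ∈ Finset.range J, (-1) ^ j * risingCoeff (k + σ) j * X⁻¹ ^ (k + j) * u ^ j| ≤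
      2 * risingCoeff (k + σ) J * X⁻¹ ^ (k + J) * |u| ^ J := by
  have hv : |u / X| ≤ 1 / 4 := by
    rw [abs_div, abs_of_pos hX, div_le_iff₀ hX]
    linarith
  have hv0 : 0 < 1 + u / X := by linarith [(abs_le.1 hv).1]
  have hbranch : (1 + u / X) ^ (-σ) * (X + u)⁻¹ ^ k =
      X⁻¹ ^ k * (1 + u / X) ^ (-(k + σ)) := by
    rw [show X + u = X * (1 + u / X) by field_simp, neg_add, Real.rpow_add hv0,
      Real.rpow_neg hv0.le (k : ℝ), Real.rpow_natCast, mul_inv, mul_pow, inv_pow (1 + u / X)]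
    ring
  have hseries : ∑ j ∈ Finset.range J, (-1) ^ j * risingCoeff (k + σ) j * X⁻¹ ^ (k + j) * u ^ j =
      X⁻¹ ^ k * ∑ j ∈ Finset.range J, (-1) ^ j * risingCoeff (k + σ) j * (u / X) ^ j := by
    rw [Finset.mul_sum]
    refine Finset.sum_congr rfl fun j _ => ?_
    rw [div_eq_mul_inv, mul_pow, pow_add]
    ring
  rw [hbranch, hseries, ← mul_sub, abs_mul, abs_of_pos (by positivity : 0 < X⁻¹ ^ k)]
  calc X⁻¹ ^ k * _ ≤ X⁻¹ ^ k * (2 * risingCoeff (k + σ) J * |u / X| ^ J) := by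
        gcongr
        exact abs_one_add_rpow_sub_le (by positivity) hJ hv
    _ = 2 * risingCoeff (k + σ) J * X⁻¹ ^ (k + J) * |u| ^ J := by
        rw [abs_div, abs_of_pos hX, div_eq_mul_inv, mul_pow, pow_add]
        ring

lemma abs_sum_weight_mul_sub_le {ι : Type*} {I : Finset ι} {w X : ι → ℝ} {c : ℕ → ℝ} {σ u : ℝ}
    {N J : ℕ} (hσ : 0 ≤ σ) (hJ : N + σ ≤ J + 3) (hw : ∀ i ∈ I, 0 ≤ w i) (hX : ∀ i ∈ I, 0 < X i)
    (hu : ∀ i ∈ I, |u| ≤ X i / 4) :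
    |∑ i ∈ I, w i * ((1 + u / X i) ^ (-σ) * ∑ k ∈ Finset.range N, c k * (X i + u)⁻¹ ^ k) -
        ∑ j ∈ Finset.range J, ((-1) ^ j * ∑ k ∈ Finset.range N, c k * risingCoeff (k + σ) j *
          ∑ i ∈ I, w i * (X i)⁻¹ ^ (k + j)) * u ^ j| ≤
      2 * (∑ k ∈ Finset.range N, |c k| * risingCoeff (k + σ) J *
        ∑ i ∈ I, w i * (X i)⁻¹ ^ (k + J)) * |u| ^ J := by
  have hdiff : ∑ i ∈ I, w i * ((1 + u / X i) ^ (-σ) *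
        ∑ k ∈ Finset.range N, c k * (X i + u)⁻¹ ^ k) -
      ∑ j ∈ Finset.range J, ((-1) ^ j * ∑ k ∈ Finset.range N, c k * risingCoeff (k + σ) j *
        ∑ i ∈ I, w i * (X i)⁻¹ ^ (k + j)) * u ^ j =
      ∑ i ∈ I, ∑ k ∈ Finset.range N, w i * c k * ((1 + u / X i) ^ (-σ) * (X i + u)⁻¹ ^ k -
        ∑ j ∈ Finset.range J,
          (-1) ^ j * risingCoeff (k + σ) j * (X i)⁻¹ ^ (k + j) * u ^ j) := by
    simp only [mul_sub, Finset.sum_sub_distrib, Finset.mul_sum, Finset.sum_mul]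
    congr 1
    · exact Finset.sum_congr rfl fun i _ => Finset.sum_congr rfl fun k _ => by ring
    · rw [Finset.sum_comm, Finset.sum_comm (s := I)]
      refine Finset.sum_congr rfl fun k _ => ?_
      rw [Finset.sum_comm]
      exact Finset.sum_congr rfl fun i _ => Finset.sum_congr rfl fun j _ => by ring
  have hbound : 2 * (∑ k ∈ Finset.range N, |c k| * risingCoeff (k + σ) J *
        ∑ i ∈ I, w i * (X i)⁻¹ ^ (k + J)) * |u| ^ J =
      ∑ i ∈ I, ∑ k ∈ Finset.range N, w i * |c k| *
        (2 * risingCoeff (k + σ) J * (X i)⁻¹ ^ (k + J) * |u| ^ J) := by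
    simp only [Finset.mul_sum, Finset.sum_mul]
    rw [Finset.sum_comm]
    exact Finset.sum_congr rfl fun i _ => Finset.sum_congr rfl fun k _ => by ring
  rw [hdiff, hbound]
  refine (Finset.abs_sum_le_sum_abs _ _).trans (Finset.sum_le_sum fun i hi =>
    (Finset.abs_sum_le_sum_abs _ _).trans (Finset.sum_le_sum fun k hk => ?_))
  have hkN : (k : ℝ) + 1 ≤ N := by exact_mod_cast Finset.mem_range.1 hk
  have hw0 := hw i hi
  rw [abs_mul, abs_mul, abs_of_nonneg hw0]
  gcongr
  exact abs_one_add_div_rpow_mul_inv_pow_sub_le hσ (by linarith) (hX i hi) (hu i hi)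

lemma cfTransfer_add_eq {A : Finset ℕ} (hA : ∀ a ∈ A, 1 ≤ a) (σ : ℝ) (f : ℝ → ℝ) {z u : ℝ}
    (hz : 0 ≤ z) (hzu : 0 ≤ z + u) :
    cfTransfer A (σ / 2) f (z + u) =
      ∑ a ∈ A, (z + a) ^ (-σ) * ((1 + u / (z + a)) ^ (-σ) * f (z + a + u)⁻¹) := by
  rw [cfTransfer_eq hA _ _ hzu, mul_div_cancel₀ σ two_ne_zero]
  refine Finset.sum_congr rfl fun a ha => ?_
  have hX : 0 < z + a := cfMap_add_pos (hA a ha) [] hz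
  have hXu : 0 < z + u + a := cfMap_add_pos (hA a ha) [] hzu
  have hsplit : z + u + a = (z + a) * (1 + u / (z + a)) := by field_simp; ring
  have hv : 0 ≤ 1 + u / (z + a) := by
    rw [hsplit] at hXu
    exact (pos_of_mul_pos_right hXu hX.le).le
  rw [← mul_assoc, ← Real.mul_rpow hX.le hv, ← hsplit, cfBranch, one_div, add_right_comm,
    mul_comm]

/-! ### An approximate eigenfunction for the alphabet `{2, 4, 6, 8, 10}` -/

/-- A rational approximation of `2 dim X_A` for `A = {2, 4, 6, 8, 10}`. -/
def twiceDim : ℚ := 1034714061874034609333256949672879467580983 / 10 ^ 42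

/-- The coefficients of a polynomial approximating the positive fixed function of `L_t` for
`t = twiceDim / 2`, normalised to take the value `1` at `0`. They were computed numerically; only
the inequalities below are used. -/
def eigCoeff (k : ℕ) : ℚ :=
  ([1000000000000000000000000000000000000000000,
    -296011209727978970671528353281055894427893,
    107006331077031165081905985331291660386624,
    -43325713625956205533277661221091992249180,
    18542990774635033117573409334781489897806,
    -8154111130458700855452356375273994652338,
    3636710982556621685638948505054972755120,
    -1635241017516892147063208762815826035191,
    739185026733442431056657926736586390256,
    -335427472391988602584127202369400577446,
    152681023622682687421233634865663851489,
    -69681897528403371972165284587903802908,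
    31877191883642607075660576763608279056,
    -14614256751560425996743076263546589701,
    6713350290705451008132823767445888300,
    -3089632791840002161145462305852485700,
    1424375138005375684951456272970721169,
    -657719850652406569549057496562233914,
    304164803474501705364738226466948824,
    -140858736175939288250125249045205140,
    65316612698228442674508769401047342,
    -30324213098041460240261570388966683,
    14094352033473222585368606632998811,
    -6557776104899816083125462808117702,
    3054162810984436548215694609643190,
    -1423705202716764535856210138061045,
    664201428097878189572455568933581,
    -310064068900181085360977079077841,
    144763456731757748416388977413380,
    -67501924925834936035528671822843,
    31324289008041737214829128255441,
    -14353510459861008750496450102904,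
    6399673103945644816375843608073,
    -2711220809832290339808306997189,
    1055209604314841693311312476586,
    -361026933820118374999544553712,
    102584004522881641326915703899,
    -22374446407634268417713981538,
    3291297052074369642772009519,
    -242713292903632729620581924] : List ℤ).getD k 0 / 10 ^ 42

/-- Lower approximations of `(2 / 7 + a) ^ (-twiceDim)` for `a = 2, 4, 6, 8, 10`. -/
def digitWeight (a : ℕ) : ℚ :=
  ([42512333833027307897149956669396994759021338,
    22183838368642894574953589829878262787764836,
    14925580505241646781020387416061196692870184,
    11214788396662242137609293475160121208078239,
    8966578893590383687186612203295579514691463] : List ℤ).getD (a / 2 - 1) 0 / 10 ^ 44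

/-- Lower approximations of `log (2 / 7 + a) / 4` for `a = 2, 4, 6, 8, 10`. -/
def quarterLog (a : ℕ) : ℚ :=
  ([2066696432961169831408939355973816356662289519,
    3638218081517105175769709870409275456528768292,
    4595698712157369644477637693595756765839055982,
    5286332153727765078737878525942271109832320796,
    5826889924901855014842085236941003459710991972] : List ℤ).getD (a / 2 - 1) 0 / 10 ^ 46

/-- The moments of the weights `digitWeight` at the points `(2 / 7 + a)⁻¹`. -/
def weightedPow (k : ℕ) : ℚ := ∑ a ∈ evenAlphabet, digitWeight a * (2 / 7 + a : ℚ)⁻¹ ^ k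

/-- The Taylor coefficients at `2 / 7` of the approximate image under `L_t` of the polynomial
with coefficients `eigCoeff`, where the factors `(2 / 7 + a) ^ (-twiceDim)` are replaced
by `digitWeight a`. -/
def imageCoeff (j : ℕ) : ℚ :=
  (-1) ^ j * ∑ k ∈ Finset.range 40, eigCoeff k * risingCoeff (k + twiceDim) j * weightedPow (k + j)

/-- The Taylor coefficients at `2 / 7` of the polynomial with coefficients `eigCoeff`. -/
def eigTaylorCoeff (j : ℕ) : ℚ :=
  ∑ k ∈ Finset.range 40, eigCoeff k * k.choose j * (2 / 7) ^ (k - j)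

/-- The Taylor polynomial of degree `35` of `exp`, a lower bound for `exp` on `[0, ∞)`. -/
def expLower (y : ℚ) : ℚ := ∑ m ∈ Finset.range 36, y ^ m / m.factorial

/-- The Taylor polynomial with the bound of `Real.exp_bound'` for its remainder, an upper bound
for `exp` on `[0, 1]`. -/
def expUpper (y : ℚ) : ℚ := expLower y + y ^ 36 * (36 + 1) / (Nat.factorial 36 * 36)

lemma abs_imageCoeff_sub_le :
    ∀ j < 44, |imageCoeff j - eigTaylorCoeff j| ≤ 5 ^ j * (1 / 10 ^ 41) := by
  decide +kernel

lemma sum_abs_eigCoeff_mul_risingCoeff_le :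
    ∑ k ∈ Finset.range 40, |eigCoeff k| * risingCoeff (k + twiceDim) 44 * weightedPow (k + 44) ≤
      5 ^ 44 * (1 / 10 ^ 40) := by
  decide +kernel

lemma sum_abs_eigCoeff_le : ∑ k ∈ Finset.range 40, |eigCoeff k| * (1 / 2) ^ k ≤ 3 / 2 := by
  decide +kernel

lemma eigCoeff_zero : eigCoeff 0 = 1 := by
  decide +kernel

lemma digitWeight_nonneg : ∀ a ∈ evenAlphabet, 0 ≤ digitWeight a := by
  decide +kernel

lemma quarterLog_mem : ∀ a ∈ evenAlphabet,
    0 ≤ quarterLog a ∧ twiceDim * (quarterLog a + 1 / 10 ^ 46) ≤ 1 := by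
  decide +kernel

lemma expUpper_quarterLog_pow_le : ∀ a ∈ evenAlphabet,
    expUpper (quarterLog a) ^ 4 ≤ 2 / 7 + a := by
  decide +kernel

lemma le_expLower_quarterLog_pow : ∀ a ∈ evenAlphabet,
    2 / 7 + a ≤ expLower (quarterLog a + 1 / 10 ^ 46) ^ 4 := by
  decide +kernel

lemma digitWeight_mul_expUpper_pow_le : ∀ a ∈ evenAlphabet,
    digitWeight a * expUpper (twiceDim * (quarterLog a + 1 / 10 ^ 46)) ^ 4 ≤ 1 := by
  decide +kernel

lemma le_digitWeight_mul_expLower_pow : ∀ a ∈ evenAlphabet,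
    1 ≤ digitWeight a * (1 + 1 / 10 ^ 42) * expLower (twiceDim * quarterLog a) ^ 4 := by
  decide +kernel

lemma one_le_of_mem_evenAlphabet : ∀ a ∈ evenAlphabet, 1 ≤ a := by
  decide

lemma twiceDim_mem_Icc : (twiceDim : ℝ) ∈ Icc (1 : ℝ) 2 := by
  constructor <;> · rw [twiceDim]; push_cast; norm_num

/-- The polynomial with coefficients `eigCoeff`. -/
noncomputable def eigPoly (x : ℝ) : ℝ := ∑ k ∈ Finset.range 40, (eigCoeff k : ℝ) * x ^ k

lemma expLower_pow_four_le {y : ℚ} (hy : 0 ≤ y) : (expLower y : ℝ) ^ 4 ≤ Real.exp (4 * y) := by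
  have hexp : (expLower y : ℝ) ≤ Real.exp y := by
    rw [expLower]
    push_cast
    exact Real.sum_le_exp_of_nonneg (Rat.cast_nonneg.2 hy) 36
  have h0 : 0 ≤ expLower y := by rw [expLower]; positivity
  calc (expLower y : ℝ) ^ 4 ≤ Real.exp y ^ 4 := by gcongr
    _ = Real.exp (4 * y) := (Real.exp_nat_mul _ 4).symm

lemma exp_four_mul_le {y : ℚ} (hy : 0 ≤ y) (hy1 : y ≤ 1) :
    Real.exp (4 * y) ≤ (expUpper y : ℝ) ^ 4 := by
  have hexp : Real.exp y ≤ expUpper y := by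
    have h := Real.exp_bound' (Rat.cast_nonneg.2 hy : (0 : ℝ) ≤ y) (by exact_mod_cast hy1)
      (n := 36) (by norm_num)
    rw [expUpper, expLower]
    push_cast at h ⊢
    exact h
  calc Real.exp (4 * y) = Real.exp y ^ 4 := Real.exp_nat_mul _ 4
    _ ≤ (expUpper y : ℝ) ^ 4 := by gcongr

lemma log_mem_Icc_quarterLog {a : ℕ} (ha : a ∈ evenAlphabet) : Real.log (2 / 7 + a) ∈
    Icc (4 * quarterLog a : ℝ) (4 * (quarterLog a + 1 / 10 ^ 46 : ℚ)) := by
  obtain ⟨h0, h1⟩ := quarterLog_mem a ha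
  have hle : quarterLog a ≤ 1 := by
    have hs : 1 ≤ twiceDim := by exact_mod_cast twiceDim_mem_Icc.1
    linarith [le_mul_of_one_le_left (by positivity : 0 ≤ quarterLog a + 1 / 10 ^ 46) hs]
  constructor
  · rw [Real.le_log_iff_exp_le (by positivity)]
    have h := (Rat.cast_le (K := ℝ)).2 (expUpper_quarterLog_pow_le a ha)
    push_cast at h
    exact (exp_four_mul_le h0 hle).trans h
  · rw [Real.log_le_iff_le_exp (by positivity)]
    have h := (Rat.cast_le (K := ℝ)).2 (le_expLower_quarterLog_pow a ha)
    push_cast at h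
    exact h.trans (expLower_pow_four_le (by positivity))

lemma rpow_neg_twiceDim_mem_Icc {a : ℕ} (ha : a ∈ evenAlphabet) :
    (2 / 7 + a : ℝ) ^ (-(twiceDim : ℝ)) ∈
    Icc (digitWeight a : ℝ) (digitWeight a * (1 + 1 / 10 ^ 42)) := by
  obtain ⟨h0, h1⟩ := quarterLog_mem a ha
  obtain ⟨hlog, hlog'⟩ := log_mem_Icc_quarterLog ha
  have hw : (0 : ℝ) ≤ digitWeight a := by exact_mod_cast digitWeight_nonneg a ha
  have hs : (0 : ℝ) ≤ twiceDim := zero_le_one.trans twiceDim_mem_Icc.1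
  have hsQ : 0 ≤ twiceDim := by exact_mod_cast hs
  have hupper : Real.exp (twiceDim * Real.log (2 / 7 + a)) ≤
      (expUpper (twiceDim * (quarterLog a + 1 / 10 ^ 46)) : ℝ) ^ 4 := by
    refine le_trans (Real.exp_le_exp.2 ?_) (exp_four_mul_le (by positivity) h1)
    rw [Rat.cast_mul, mul_left_comm]
    gcongr
  have hlower : (expLower (twiceDim * quarterLog a) : ℝ) ^ 4 ≤
      Real.exp (twiceDim * Real.log (2 / 7 + a)) := by
    refine (expLower_pow_four_le (by positivity)).trans (Real.exp_le_exp.2 ?_)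
    rw [Rat.cast_mul, mul_left_comm]
    gcongr
  rw [Real.rpow_neg (by positivity), Real.rpow_def_of_pos (by positivity), mul_comm (Real.log _),
    ← one_div, mem_Icc, le_div_iff₀ (Real.exp_pos _), div_le_iff₀ (Real.exp_pos _)]
  constructor
  · calc (digitWeight a : ℝ) * Real.exp (twiceDim * Real.log (2 / 7 + a))
        ≤ digitWeight a * (expUpper (twiceDim * (quarterLog a + 1 / 10 ^ 46)) : ℝ) ^ 4 := by gcongr
      _ ≤ 1 := by exact_mod_cast digitWeight_mul_expUpper_pow_le a ha
  · calc (1 : ℝ) ≤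
          digitWeight a * (1 + 1 / 10 ^ 42) * (expLower (twiceDim * quarterLog a) : ℝ) ^ 4 := by
          have h := (Rat.cast_le (K := ℝ)).2 (le_digitWeight_mul_expLower_pow a ha)
          push_cast at h
          exact h
      _ ≤ digitWeight a * (1 + 1 / 10 ^ 42) * Real.exp (twiceDim * Real.log (2 / 7 + a)) := by
          gcongr

lemma cfBranch_mem_Icc_of_mem_evenAlphabet {a : ℕ} (ha : a ∈ evenAlphabet)
    {x : ℝ} (hx : x ∈ Icc (3 / 35 : ℝ) (17 / 35)) :
    cfBranch a x ∈ Icc (3 / 35 : ℝ) (17 / 35) := by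
  have hbounds : ∀ b ∈ evenAlphabet, 2 ≤ b ∧ b ≤ 10 := by decide
  have ha2 : (2 : ℝ) ≤ a := by exact_mod_cast (hbounds a ha).1
  have ha10 : (a : ℝ) ≤ 10 := by exact_mod_cast (hbounds a ha).2
  have hpos : 0 < x + a := by linarith [hx.1]
  rw [cfBranch, mem_Icc, le_div_iff₀ hpos, div_le_iff₀ hpos]
  constructor <;> linarith [hx.1, hx.2]

lemma eigPoly_mem_Icc {x : ℝ} (hx : x ∈ Icc (0 : ℝ) (1 / 2)) :
    eigPoly x ∈ Icc (1 / 2 : ℝ) (3 / 2) := by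
  have hcoeff := (Rat.cast_le (K := ℝ)).2 sum_abs_eigCoeff_le
  push_cast at hcoeff
  rw [Finset.sum_range_succ'] at hcoeff
  have htail : |∑ k ∈ Finset.range 39, (eigCoeff (k + 1) : ℝ) * x ^ (k + 1)| ≤
      ∑ k ∈ Finset.range 39, |(eigCoeff (k + 1) : ℝ)| * (1 / 2) ^ (k + 1) := by
    refine (Finset.abs_sum_le_sum_abs _ _).trans (Finset.sum_le_sum fun k _ => ?_)
    rw [abs_mul, abs_pow, abs_of_nonneg hx.1]
    gcongr
    exacts [hx.1, hx.2]
  rw [eigPoly, Finset.sum_range_succ']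
  simp only [eigCoeff_zero, Rat.cast_one, pow_zero, mul_one, abs_one] at hcoeff ⊢
  rw [abs_le] at htail
  constructor <;> linarith [htail.1, htail.2]

lemma eigPoly_cfBranch_pos {a : ℕ} (ha : a ∈ evenAlphabet) {x : ℝ}
    (hx : x ∈ Icc (3 / 35 : ℝ) (17 / 35)) : 0 < eigPoly (cfBranch a x) := by
  have hbranch := cfBranch_mem_Icc_of_mem_evenAlphabet ha hx
  exact one_half_pos.trans_le
    (eigPoly_mem_Icc ⟨by linarith [hbranch.1], by linarith [hbranch.2]⟩).1

lemma eigPoly_add_eq (u : ℝ) :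
    eigPoly (2 / 7 + u) = ∑ j ∈ Finset.range 44, (eigTaylorCoeff j : ℝ) * u ^ j := by
  rw [eigPoly, sum_mul_add_pow_eq _ (by norm_num : 40 ≤ 44)]
  refine Finset.sum_congr rfl fun j _ => ?_
  rw [eigTaylorCoeff]
  push_cast
  rfl

lemma abs_sum_imageCoeff_sub_eigPoly_le {u : ℝ} (hu : |u| ≤ 1 / 5) :
    |∑ j ∈ Finset.range 44, (imageCoeff j : ℝ) * u ^ j - eigPoly (2 / 7 + u)| ≤ 44 / 10 ^ 41 := by
  have hterm : ∀ j ∈ Finset.range 44,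
      |(imageCoeff j : ℝ) * u ^ j - (eigTaylorCoeff j : ℝ) * u ^ j| ≤ 1 / 10 ^ 41 := by
    intro j hj
    have h := (Rat.cast_le (K := ℝ)).2 (abs_imageCoeff_sub_le j (Finset.mem_range.1 hj))
    push_cast at h
    rw [← sub_mul, abs_mul, abs_pow]
    calc |(imageCoeff j : ℝ) - eigTaylorCoeff j| * |u| ^ j
        ≤ (5 ^ j * (1 / 10 ^ 41)) * (1 / 5) ^ j := by gcongr
      _ = 1 / 10 ^ 41 := by rw [one_div_pow]; field_simp
  rw [eigPoly_add_eq, ← Finset.sum_sub_distrib]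
  calc _ ≤ ∑ _j ∈ Finset.range 44, (1 / 10 ^ 41 : ℝ) :=
        (Finset.abs_sum_le_sum_abs _ _).trans (Finset.sum_le_sum hterm)
    _ = 44 / 10 ^ 41 := by rw [Finset.sum_const, Finset.card_range, nsmul_eq_mul]; norm_num

lemma abs_sum_digitWeight_sub_sum_imageCoeff_le {u : ℝ} (hu : |u| ≤ 1 / 5) :
    |∑ a ∈ evenAlphabet, (digitWeight a : ℝ) *
        ((1 + u / (2 / 7 + a)) ^ (-(twiceDim : ℝ)) * eigPoly (2 / 7 + a + u)⁻¹) -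
      ∑ j ∈ Finset.range 44, (imageCoeff j : ℝ) * u ^ j| ≤ 2 / 10 ^ 40 := by
  have himage (j : ℕ) : (imageCoeff j : ℝ) = (-1) ^ j * ∑ k ∈ Finset.range 40, (eigCoeff k : ℝ) *
      risingCoeff (k + twiceDim : ℝ) j *
        ∑ a ∈ evenAlphabet, (digitWeight a : ℝ) * (2 / 7 + a : ℝ)⁻¹ ^ (k + j) := by
    simp only [imageCoeff, weightedPow]
    push_cast [cast_risingCoeff]
    rfl
  have htrunc := (Rat.cast_le (K := ℝ)).2 sum_abs_eigCoeff_mul_risingCoeff_le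
  simp only [weightedPow] at htrunc
  push_cast [cast_risingCoeff] at htrunc
  have hu' : ∀ a ∈ evenAlphabet, |u| ≤ (2 / 7 + a : ℝ) / 4 := fun a ha => by
    have ha1 : (1 : ℝ) ≤ a := by exact_mod_cast one_le_of_mem_evenAlphabet a ha
    linarith
  simp only [himage, eigPoly]
  refine (abs_sum_weight_mul_sub_le (zero_le_one.trans twiceDim_mem_Icc.1)
    (by push_cast; linarith [twiceDim_mem_Icc.2])
    (fun a ha => by exact_mod_cast digitWeight_nonneg a ha) (fun a _ => by positivity) hu').trans ?_
  calc _ ≤ 2 * (5 ^ 44 * (1 / 10 ^ 40)) * (1 / 5 : ℝ) ^ 44 := by gcongr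
    _ = 2 / 10 ^ 40 := by norm_num

lemma cfTransfer_eigPoly_mem_Icc {x : ℝ} (hx : x ∈ Icc (3 / 35 : ℝ) (17 / 35)) :
    cfTransfer evenAlphabet (twiceDim / 2) eigPoly x ∈
      Icc ((1 - 2 / 10 ^ 39) * eigPoly x) ((1 + 4 / 10 ^ 39) * eigPoly x) := by
  obtain ⟨u, rfl⟩ : ∃ u, x = 2 / 7 + u := ⟨x - 2 / 7, by ring⟩
  have hu : |u| ≤ 1 / 5 := abs_le.2 ⟨by linarith [hx.1], by linarith [hx.2]⟩
  have hhalf := (eigPoly_mem_Icc (x := 2 / 7 + u) ⟨by linarith [hx.1], by linarith [hx.2]⟩).1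
  set B : ℕ → ℝ := fun a =>
    (1 + u / (2 / 7 + a)) ^ (-(twiceDim : ℝ)) * eigPoly (2 / 7 + a + u)⁻¹
  have hB0 : ∀ a ∈ evenAlphabet, 0 ≤ B a := fun a ha => by
    have hf := eigPoly_cfBranch_pos ha hx
    rw [cfBranch, one_div, add_right_comm] at hf
    have ha1 : (1 : ℝ) ≤ a := by exact_mod_cast one_le_of_mem_evenAlphabet a ha
    have hv : 0 ≤ 1 + u / (2 / 7 + a) := by
      rw [one_add_div (by positivity)]
      exact div_nonneg (by linarith [hx.1]) (by positivity)
    exact mul_nonneg (Real.rpow_nonneg hv _) hf.le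
  have hresidual : |∑ a ∈ evenAlphabet, (digitWeight a : ℝ) * B a - eigPoly (2 / 7 + u)| ≤
      1 / 10 ^ 39 :=
    (abs_sub_le _ _ _).trans ((add_le_add (abs_sum_digitWeight_sub_sum_imageCoeff_le hu)
      (abs_sum_imageCoeff_sub_eigPoly_le hu)).trans (by norm_num))
  have hlow : ∑ a ∈ evenAlphabet, (digitWeight a : ℝ) * B a ≤
      ∑ a ∈ evenAlphabet, (2 / 7 + a : ℝ) ^ (-(twiceDim : ℝ)) * B a :=
    Finset.sum_le_sum fun a ha =>
      mul_le_mul_of_nonneg_right (rpow_neg_twiceDim_mem_Icc ha).1 (hB0 a ha)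
  have hupp : ∑ a ∈ evenAlphabet, (2 / 7 + a : ℝ) ^ (-(twiceDim : ℝ)) * B a ≤
      (1 + 1 / 10 ^ 42) * ∑ a ∈ evenAlphabet, (digitWeight a : ℝ) * B a := by
    rw [Finset.mul_sum]
    exact Finset.sum_le_sum fun a ha => (mul_le_mul_of_nonneg_right
      (rpow_neg_twiceDim_mem_Icc ha).2 (hB0 a ha)).trans_eq (by ring)
  rw [cfTransfer_add_eq one_le_of_mem_evenAlphabet _ _ (by norm_num) (by linarith [hx.1])]
  obtain ⟨hres1, hres2⟩ := abs_le.1 hresidual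
  constructor <;> linarith

lemma one_add_mul_cfTransfer_le {A : Finset ℕ} (hA : ∀ a ∈ A, 2 ≤ a) {f : ℝ → ℝ} {t η x : ℝ}
    (hη : 0 ≤ η) (hx : 0 ≤ x) (hf : ∀ a ∈ A, 0 ≤ f (cfBranch a x)) :
    (1 + η) * cfTransfer A (t + η) f x ≤ cfTransfer A t f x := by
  refine mul_cfTransfer_le_cfTransfer (fun a ha => one_le_two.trans (hA a ha)) hx hf fun a ha => ?_
  have ha2 : (2 : ℝ) ≤ x + a := by
    have : (2 : ℝ) ≤ a := by exact_mod_cast hA a ha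
    linarith
  calc 1 + η ≤ Real.log 2 * (2 * η) + 1 := by nlinarith [Real.log_two_gt_d9]
    _ ≤ Real.exp (Real.log 2 * (2 * η)) := Real.add_one_le_exp _
    _ = 2 ^ (2 * η) := (Real.rpow_def_of_pos two_pos _).symm
    _ ≤ (x + a) ^ (2 * η) := by gcongr
    _ = (x + a) ^ (2 * (t + η - t)) := by rw [add_sub_cancel_left]

theorem dimH_cfLimitSet_evenAlphabet_mem_Icc : dimH (cfLimitSet evenAlphabet) ∈
    Icc (ENNReal.ofReal (twiceDim / 2 - 4 / 10 ^ 38))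
      (ENNReal.ofReal (twiceDim / 2 + 9 / 10 ^ 39)) := by
  have hs := twiceDim_mem_Icc.1
  have hA2 : ∀ a ∈ evenAlphabet, 2 ≤ a := by decide
  have hJ : Icc (3 / 35 : ℝ) (17 / 35) ⊆ Icc 0 1 := Icc_subset_Icc (by norm_num) (by norm_num)
  have hJne : (Icc (3 / 35 : ℝ) (17 / 35)).Nonempty := nonempty_Icc.2 (by norm_num)
  have hf : ∀ x ∈ Icc (3 / 35 : ℝ) (17 / 35), eigPoly x ∈ Icc (1 / 2 : ℝ) (3 / 2) :=
    fun x hx => eigPoly_mem_Icc ⟨by linarith [hx.1], by linarith [hx.2]⟩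
  have hraise {t η : ℝ} (hη : 0 ≤ η) {x : ℝ} (hx : x ∈ Icc (3 / 35 : ℝ) (17 / 35)) :
      (1 + η) * cfTransfer evenAlphabet (t + η) eigPoly x ≤ cfTransfer evenAlphabet t eigPoly x :=
    one_add_mul_cfTransfer_le hA2 hη (hJ hx).1 fun a ha => (eigPoly_cfBranch_pos ha hx).le
  constructor
  · refine le_dimH_of_le_cfTransfer one_le_of_mem_evenAlphabet (by linarith) hJ hJne
      (fun a ha x => cfBranch_mem_Icc_of_mem_evenAlphabet ha) one_half_pos hf fun x hx => ?_
    have h := hraise (t := twiceDim / 2 - 4 / 10 ^ 38) (by norm_num : (0 : ℝ) ≤ 4 / 10 ^ 38) hx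
    rw [sub_add_cancel] at h
    linarith [(cfTransfer_eigPoly_mem_Icc hx).1, (hf x hx).1]
  · refine dimH_le_of_cfTransfer_le one_le_of_mem_evenAlphabet (by linarith) hJ hJne
      (fun a ha x => cfBranch_mem_Icc_of_mem_evenAlphabet ha) one_half_pos hf fun x hx => ?_
    have h := hraise (t := twiceDim / 2) (by norm_num : (0 : ℝ) ≤ 9 / 10 ^ 39) hx
    linarith [(cfTransfer_eigPoly_mem_Icc hx).2, (hf x hx).1]

theorem lt_dimH_cfLimitSet_evenAlphabet :
    ENNReal.ofReal 0.5173570309370173046666284748364397337 < dimH (cfLimitSet evenAlphabet) := by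
  refine lt_of_lt_of_le ?_ dimH_cfLimitSet_evenAlphabet_mem_Icc.1
  rw [ENNReal.ofReal_lt_ofReal_iff_of_nonneg (by norm_num), twiceDim]
  norm_num

theorem dimH_cfLimitSet_evenAlphabet_lt : dimH (cfLimitSet evenAlphabet) <
    ENNReal.ofReal (0.5173570309370173046666284748364397337 + 10 ^ (-37 : ℤ)) := by
  refine lt_of_le_of_lt dimH_cfLimitSet_evenAlphabet_mem_Icc.2 ?_
  rw [ENNReal.ofReal_lt_ofReal_iff (by norm_num), twiceDim]
  norm_num

theorem one_half_lt_dimH_cfLimitSet_evenAlphabet :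
    (1 / 2 : ℝ≥0∞) < dimH (cfLimitSet evenAlphabet) := by
  have hhalf : (1 / 2 : ℝ≥0∞) = ENNReal.ofReal (1 / 2) := by
    rw [ENNReal.ofReal_div_of_pos two_pos, ENNReal.ofReal_one, ENNReal.ofReal_ofNat]
  refine lt_trans ?_ lt_dimH_cfLimitSet_evenAlphabet
  rw [hhalf, ENNReal.ofReal_lt_ofReal_iff (by norm_num)]
  norm_num

/-! ### The test function `8 - 2 x` -/

lemma isPositiveHolder_eight_sub_two_mul : IsPositiveHolder fun x => 8 - 2 * x := by
  refine ⟨⟨2, 1, one_pos, le_rfl, ?_⟩, fun x hx => by linarith [hx.2]⟩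
  rw [holderOnWith_one]
  refine LipschitzOnWith.of_dist_le_mul fun x _ y _ => ?_
  rw [dist_sub_left, Real.dist_eq, Real.dist_eq, ← mul_sub, abs_mul, abs_two, NNReal.coe_ofNat]

/-- The left-hand side is the tangent at `c` of the function `y ↦ 8 / y - 2 / y ^ 2` on the right,
which is convex for `y ≥ 3 / 4`. -/
lemma tangent_le_eight_sub_mul_inv {y c : ℝ} (hy : 2 ≤ y) (hc : 2 ≤ c) :
    8 / c - 2 / c ^ 2 + (-8 / c ^ 2 + 4 / c ^ 3) * (y - c) ≤ (8 - 2 * (1 / y)) * y⁻¹ := by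
  have hy0 : 0 < y := two_pos.trans_le hy
  have hc0 : 0 < c := two_pos.trans_le hc
  have hdiff : (8 - 2 * (1 / y)) * y⁻¹ -
      (8 / c - 2 / c ^ 2 + (-8 / c ^ 2 + 4 / c ^ 3) * (y - c)) =
      (y - c) ^ 2 * (8 * (y * c) - 2 * c - 4 * y) / (y ^ 2 * c ^ 3) := by
    field_simp
    ring
  have hfactor : 0 ≤ 8 * (y * c) - 2 * c - 4 * y := by nlinarith
  rw [← sub_nonneg, hdiff]
  exact div_nonneg (mul_nonneg (sq_nonneg _) hfactor)
    (mul_pos (pow_pos hy0 2) (pow_pos hc0 3)).le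

lemma one_lt_iInf_eight_sub_two_mul : 1 < ⨅ x : Icc (0 : ℝ) 1,
    cfTransfer evenAlphabet (1 / 2) (fun y => 8 - 2 * y) x / (8 - 2 * (x : ℝ)) := by
  have : Nonempty (Icc (0 : ℝ) 1) := ⟨⟨0, left_mem_Icc.2 zero_le_one⟩⟩
  refine lt_of_lt_of_le (by norm_num : (1 : ℝ) < 1.01) (le_ciInf fun ⟨x, hx⟩ => ?_)
  have hx0 := hx.1
  have hx1 := hx.2
  have hweight (y : ℝ) : y ^ (-(2 * (1 / 2 : ℝ))) = y⁻¹ := by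
    rw [mul_one_div_cancel two_ne_zero, Real.rpow_neg_one]
  -- tangents at the values `1 / 2 + a` of `x + a` in the middle of the interval
  have h2 := tangent_le_eight_sub_mul_inv (y := x + 2) (c := 5 / 2) (by linarith) (by norm_num)
  have h4 := tangent_le_eight_sub_mul_inv (y := x + 4) (c := 9 / 2) (by linarith) (by norm_num)
  have h6 := tangent_le_eight_sub_mul_inv (y := x + 6) (c := 13 / 2) (by linarith) (by norm_num)
  have h8 := tangent_le_eight_sub_mul_inv (y := x + 8) (c := 17 / 2) (by linarith) (by norm_num)
  have h10 := tangent_le_eight_sub_mul_inv (y := x + 10) (c := 21 / 2) (by linarith) (by norm_num)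
  rw [le_div_iff₀ (by linarith), cfTransfer_eq one_le_of_mem_evenAlphabet _ _ hx0]
  simp only [hweight, cfBranch, evenAlphabet]
  rw [Finset.sum_insert (by decide), Finset.sum_insert (by decide), Finset.sum_insert (by decide),
    Finset.sum_insert (by decide), Finset.sum_singleton]
  push_cast
  norm_num at h2 h4 h6 h8 h10 ⊢
  linarith

/-! ### The obstruction modulo four -/

/-- The residues modulo `4` of the pairs (numerator, denominator) of continued fractions with even
digits. -/
def evenResidues : Finset (ZMod 4 × ZMod 4) := {(0, 1), (2, 1), (1, 0), (1, 2)}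

lemma evenResidues_step : ∀ p q b : ZMod 4, (p, q) ∈ evenResidues →
    (q, p + (b + b) * q) ∈ evenResidues := by
  decide

lemma exists_coprime_cfValue_eq {l : List ℕ} (hl : ∀ a ∈ l, 1 ≤ a ∧ Even a) :
    ∃ p q : ℕ, 0 < q ∧ Nat.Coprime p q ∧ cfValue l = (p : ℝ) / q ∧
      ((p : ZMod 4), (q : ZMod 4)) ∈ evenResidues := by
  induction l with
  | nil => exact ⟨0, 1, one_pos, Nat.coprime_one_right 0, by simp [cfValue], by decide⟩
  | cons a l ih =>
    obtain ⟨⟨ha, b, rfl⟩, hl'⟩ := List.forall_mem_cons.1 hl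
    obtain ⟨p, q, hq, hpq, hvalue, hres⟩ := ih hl'
    refine ⟨q, p + (b + b) * q, Nat.add_pos_right p (Nat.mul_pos ha hq), ?_, ?_, ?_⟩
    · rw [Nat.coprime_add_mul_right_right]
      exact hpq.symm
    · have hq0 : (q : ℝ) ≠ 0 := by exact_mod_cast hq.ne'
      change 1 / (cfValue l + ((b + b : ℕ) : ℝ)) = _
      rw [hvalue]
      push_cast
      field_simp
    · push_cast
      exact evenResidues_step _ _ _ hres

theorem not_modEq_three_of_hasDigitsIn {A : Finset ℕ} (hA : ∀ a ∈ A, 1 ≤ a ∧ Even a)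
    {p q : ℕ} (hpq : Nat.Coprime p q)
    (h : HasDigitsIn A p q) : ¬ q ≡ 3 [MOD 4] := by
  intro hq
  obtain ⟨l, -, hl, hvalue⟩ := h
  obtain ⟨r, s, hs, hrs, hvalue', hres⟩ := exists_coprime_cfValue_eq fun a ha => hA a (hl a ha)
  have hq0 : q ≠ 0 := by
    rintro rfl
    exact absurd hq (by decide)
  have hcross : p * s = r * q := by
    rw [hvalue', div_eq_div_iff (by positivity) (by positivity)] at hvalue
    exact_mod_cast hvalue
  have hqs : q = s := Nat.dvd_antisymm
    (hpq.symm.dvd_of_dvd_mul_left ⟨r, by rw [hcross, mul_comm]⟩)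
    (hrs.symm.dvd_of_dvd_mul_left ⟨p, by rw [← hcross, mul_comm]⟩)
  have hthree : ∀ x : ZMod 4, (x, 3) ∉ evenResidues := by decide
  rw [← hqs, (ZMod.natCast_eq_natCast_iff q 3 4).2 hq] at hres
  exact hthree _ hres

theorem not_hensleyProperty {A : Finset ℕ} (hA : ∀ a ∈ A, 1 ≤ a ∧ Even a) :
    ¬ HensleyProperty A := by
  rintro ⟨q₀, -, h⟩
  obtain ⟨q, hq, hprime, hmod⟩ :=
    Nat.forall_exists_prime_gt_and_modEq q₀ (q := 4) (a := 3) (by norm_num) (by decide)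
  obtain ⟨p, hpq, hdigits⟩ := h q hq.le
  have hp : p ≠ 0 := by
    rintro rfl
    obtain ⟨l, hne, hl, hvalue⟩ := hdigits
    obtain ⟨a, l, rfl⟩ := List.exists_cons_of_ne_nil hne
    have hpos := cfMap_add_pos (hA a (hl a List.mem_cons_self)).1 l le_rfl
    rw [Nat.cast_zero, zero_div, cfValue_eq_cfMap, cfMap_cons, cfBranch] at hvalue
    exact (one_div_pos.2 hpos).ne hvalue
  exact not_modEq_three_of_hasDigitsIn hA (Nat.coprime_of_lt_prime hp hpq hprime).symm hdigits hmod

theorem not_hensleyConjecture : ¬ HensleyConjecture := fun h =>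
  not_hensleyProperty (by decide)
    (h evenAlphabet one_le_of_mem_evenAlphabet one_half_lt_dimH_cfLimitSet_evenAlphabet)

theorem mainTheorem11_general :
    (ENNReal.ofReal 0.5173570309370173046666284748364397337 < dimH (cfLimitSet evenAlphabet) ∧
      dimH (cfLimitSet evenAlphabet) <
        ENNReal.ofReal (0.5173570309370173046666284748364397337 + 10 ^ (-37 : ℤ))) ∧
    (1 / 2 : ℝ≥0∞) < dimH (cfLimitSet evenAlphabet) ∧
    (∀ A : Finset ℕ, (∀ a ∈ A, 1 ≤ a) → ∀ t : ℝ, 0 ≤ t → ∀ f : ℝ → ℝ, ContinuousOn f (Icc 0 1) →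
      (∀ x ∈ Icc (0 : ℝ) 1, 0 < f x) → 1 < ⨅ x : Icc (0 : ℝ) 1, cfTransfer A t f x / f x →
      ENNReal.ofReal t < dimH (cfLimitSet A)) ∧
    (IsPositiveHolder (fun x => 8 - 2 * x) ∧
      1 < ⨅ x : Icc (0 : ℝ) 1,
        cfTransfer evenAlphabet (1 / 2) (fun y => 8 - 2 * y) x / (8 - 2 * (x : ℝ))) ∧
    (∀ A : Finset ℕ, (∀ a ∈ A, 1 ≤ a ∧ Even a) →
      (∀ p q : ℕ, Nat.Coprime p q → HasDigitsIn A p q → ¬ q ≡ 3 [MOD 4]) ∧ ¬ HensleyProperty A) ∧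
    ¬ HensleyConjecture :=
  ⟨⟨lt_dimH_cfLimitSet_evenAlphabet, dimH_cfLimitSet_evenAlphabet_lt⟩,
    one_half_lt_dimH_cfLimitSet_evenAlphabet,
    fun _ hA _ ht _ hf hpos h => lt_dimH_of_one_lt_iInf hA ht hf hpos h,
    ⟨isPositiveHolder_eight_sub_two_mul, one_lt_iInf_eight_sub_two_mul⟩,
    fun _ hA => ⟨fun _ _ => not_modEq_three_of_hasDigitsIn hA, not_hensleyProperty hA⟩,
    not_hensleyConjecture⟩

theorem mainTheorem11 :
    -- the dimension to 37 digits
    (ENNReal.ofReal 0.5173570309370173046666284748364397337 < dimH (cfLimitSet evenAlphabet) ∧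
      dimH (cfLimitSet evenAlphabet) <
        ENNReal.ofReal (0.5173570309370173046666284748364397337 + 10 ^ (-37 : ℤ))) ∧
    -- in particular it exceeds one half
    (1 / 2 : ℝ≥0∞) < dimH (cfLimitSet evenAlphabet) ∧
    -- test functions bound the dimension from below
    (∀ t ∈ Icc (0 : ℝ) 1, ∀ f : ℝ → ℝ, IsPositiveHolder f →
      1 < ⨅ x : Icc (0 : ℝ) 1, cfTransfer evenAlphabet t f x / f x →
      ENNReal.ofReal t < dimH (cfLimitSet evenAlphabet)) ∧
    -- and `8 - 2 x` is such a test function for the bound one half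
    (IsPositiveHolder (fun x => 8 - 2 * x) ∧
      1 < ⨅ x : Icc (0 : ℝ) 1,
        cfTransfer evenAlphabet (1 / 2) (fun y => 8 - 2 * y) x / (8 - 2 * (x : ℝ))) ∧
    -- the obstruction modulo 4
    (∀ p q : ℕ, Nat.Coprime p q → HasDigitsIn evenAlphabet p q → ¬ q ≡ 3 [MOD 4]) ∧
    -- the counterexample to the conjecture
    ¬ HensleyProperty evenAlphabet ∧ ¬ HensleyConjecture := by
  obtain ⟨hdim, hhalf, htest, height, hmod, hconj⟩ := mainTheorem11_general
  obtain ⟨hmod₄, hhensley⟩ := hmod evenAlphabet (by decide)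
  exact ⟨hdim, hhalf, fun t ht f hf => htest _ one_le_of_mem_evenAlphabet t ht.1 f
    hf.continuousOn hf.2, height, hmod₄, hhensley, hconj⟩
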